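/- Let $n \ge 0$ and let $d \ge 3$ be an odd integer. Let $f:\mathbb{R}^n\to\mathbb{R}$ be $d$ times continuously differentiable, with all sublevel sets $\{x : f(x)\le c\}$ bounded, with $\nabla^2 f(x)\succ 0$ for every $x\in\mathbb{R}^n$, and with $\|\nabla^d f(x)-\nabla^d f(y)\|\le M\|x-y\|$ for all $x,y\in\mathbb{R}^n$, where $M\ge 0$, the vector norm is Euclidean and $\|D\|=\max_{\|u_1\|,\dots,\|u_d\|\le 1}\langle D,u_1\otimes\cdots\otimes u_d\rangle$ for a $d$-th order tensor $D$. For $a\in\mathbb{R}^n$ let $T_{a,d}(x)=\sum_{i=0}^d\frac1{i!}\langle\nabla^i f(a),(x-a)^{\otimes i}\rangle$ be the Taylor expansion of $f$ of order $d$ at $a$. A polynomial $p$ on $\mathbb{R}^n$ is called sos-convex if the polynomial $(x,y)\mapsto y^T\nabla^2p(x)\,y$ is a sum of squares of polynomials. Let $t(a)$ be the optimal value (infimum) of the program of minimizing $t$ over all real $t\ge 0$ for which the polynomial $x\mapsto T_{a,d}(x)+t\|x-a\|^{d+1}$ is sos-convex, and put $$\psi_a(x)=T_{a,d}(x)+\max\Big\{\frac{dM}{(d+1)!},\,t(a)\Big\}\|x-a\|^{d+1}.$$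 Consider the algorithm that, from a starting point $x_0\in\mathbb{R}^n$, takes $x_{k+1}$ to be the minimizer of $\psi_{x_k}$ for $k=0,1,2,\dots$. Then: 1. The algorithm is well defined: for every $a\in\mathbb{R}^n$ the program defining $t(a)$ is feasible, and $\psi_a$ has exactly one global minimizer. 2. $f$ has exactly one global minimizer $x^*$, and for every starting point $x_0\in\mathbb{R}^n$ the iterates satisfy $x_k\to x^*$ and there is a constant $C$ (which may depend on $x_0$) with $f(x_k)-f(x^*)\le C\,k^{-d}$ for all $k\ge1$. 3. The algorithm converges locally with order $d$: there are constants $r,c>0$ such that, whenever $\|x_0-x^*\|\le r$, one has $\|x_{k+1}-x^*\|\le c\,\|x_k-x^*\|^d$ for all $k\ge 0$. -/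

import Mathlib

open scoped NNReal

noncomputable section

/-- `ℝⁿ` with the Euclidean norm. -/
abbrev RSpace (n : ℕ) : Type := EuclideanSpace ℝ (Fin n)

/-- The polynomial `yᵀ ∇²p(x) y` in the `2n` variables `(x, y)`:
`Sum.inl i` is the variable `xᵢ` and `Sum.inr i` is the variable `yᵢ`. -/
def hessianForm {n : ℕ} (p : MvPolynomial (Fin n) ℝ) :
    MvPolynomial (Fin n ⊕ Fin n) ℝ :=
  ∑ i : Fin n, ∑ j : Fin n,
    MvPolynomial.X (Sum.inr i) *
      MvPolynomial.rename Sum.inl (MvPolynomial.pderiv i (MvPolynomial.pderiv j p)) *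
      MvPolynomial.X (Sum.inr j)

/-- The function `g : ℝⁿ → ℝ` is an sos-convex polynomial: it is the evaluation of a polynomial `p`
(unique, as `ℝ` is infinite) for which `yᵀ ∇²p(x) y` is a sum of squares of polynomials. -/
def IsSOSConvex {n : ℕ} (g : RSpace n → ℝ) : Prop :=
  ∃ p : MvPolynomial (Fin n) ℝ,
    (∀ x : RSpace n, MvPolynomial.eval (fun i => x i) p = g x) ∧ IsSumSq (hessianForm p)

/-- The Taylor expansion of `f` of order `d` at `a`, evaluated at `x`. -/
def taylorExpansion {n : ℕ} (f : RSpace n → ℝ) (d : ℕ) (a x : RSpace n) : ℝ :=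
  ∑ i ∈ Finset.range (d + 1),
    (1 / (i.factorial : ℝ)) * iteratedFDeriv ℝ i f a (fun _ => x - a)

/-- The smallest even integer greater than `d`. -/
def nextEven (d : ℕ) : ℕ := 2 * (d / 2 + 1)

/-- The feasible set of the program: minimize `t` subject to `t ≥ 0` and
`T_{a,d}(x) + t ‖x - a‖^{d'}` being sos-convex in `x`. -/
def feasibleReg {n : ℕ} (f : RSpace n → ℝ) (d : ℕ) (a : RSpace n) : Set ℝ :=
  {t : ℝ | 0 ≤ t ∧
    IsSOSConvex (fun x : RSpace n => taylorExpansion f d a x + t * ‖x - a‖ ^ nextEven d)}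

/-- The optimal value `t(a)` of the program above. The feasible set is bounded below by `0`, so this
is the genuine infimum whenever the program is feasible. -/
def optReg {n : ℕ} (f : RSpace n → ℝ) (d : ℕ) (a : RSpace n) : ℝ :=
  sInf (feasibleReg f d a)

/-- The regularized model `T_{a,d}(x) + max {dM/(d+1)!, t(a)} ‖x - a‖^{d+1}`. -/
def globalModel {n : ℕ} (f : RSpace n → ℝ) (d : ℕ) (M : ℝ) (a x : RSpace n) : ℝ :=
  taylorExpansion f d a x +
    max ((d : ℝ) * M / ((d + 1).factorial : ℝ)) (optReg f d a) * ‖x - a‖ ^ (d + 1)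

/-- `y` is a global minimizer of `g`. -/
def IsGlobalMinimizer {n : ℕ} (g : RSpace n → ℝ) (y : RSpace n) : Prop :=
  ∀ z : RSpace n, g y ≤ g z

/-- `x 0, x 1, …` are the iterates of the globally convergent `d`-th order Newton method
started at `x 0`. -/
def IsGlobalNewtonSequence {n : ℕ} (f : RSpace n → ℝ) (d : ℕ) (M : ℝ) (x : ℕ → RSpace n) : Prop :=
  ∀ k : ℕ, IsGlobalMinimizer (globalModel f d M (x k)) (x (k + 1))

end

/-! ### Taylor remainders, convexity along lines, quadratic growth. -/

section Calculus

/-! Feasibility is algebraic. Let `D` be the derivation with `D xᵢ = yᵢ` and `D yᵢ = 0`; the Hessian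
form of `p` is `D (D p)`. After translating `a` to the origin, the Hessian form of the model
consists of the form of `∇²f(a)`, which exceeds `μ|y|²` by a sum of squares, of terms quadratic in
`y` and of degree between `1` and `d - 2` in `x`, and of the regularizer's part, which dominates
`t|y|²|x|^(d-1)`. By weighted AM-GM, written as identities between sums of squares, the middle terms
are absorbed by `μ|y|² + t|y|²|x|^(d-1)` for large `t` (`exists_isSumSq_absorb`). The required `t`
depends only on `μ` and on a bound for the coefficients, so one `t` serves a whole compact set of
centers (`exists_uniform_feasible`).

The model is thus a convex polynomial, strictly curved at `a` in every direction. This makes it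
unbounded above on each ray from `a`, whence existence of a minimizer; uniqueness holds because a
polynomial constant on a segment is constant on the line.

Since `dM/(d+1)! ≥ M/(d+1)!`, the model majorizes `f`, and on compact sets it exceeds `f` by at most
a multiple of `‖x - a‖^(d+1)`. Hence the iterates stay in a compact sublevel set, where the
parameters are bounded, and each step does at least as well as any trial point up to that error
(`step_le`). Trial points on the segment to `x*` give the rate `k^(-d)`; quadratic growth of `f`
turns it into convergence of the iterates.

For the local order, `f` minus the model is Lipschitz with constant `O(ρ^d)` on the ball of radius
`ρ` about `a`. Comparing the new iterate with `x*` gives `‖y - x*‖² = O(ρ^d ‖y - x*‖)`; cancelling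
one factor leaves order `d`. -/

/-- Taylor's theorem on `[0, 1]` for a chain of successive derivatives whose last member satisfies a
Lipschitz bound at `0`. -/
theorem abs_sub_taylor_le {C : ℝ} : ∀ (d : ℕ) (h : ℕ → ℝ → ℝ),
    (∀ i < d, ∀ s, HasDerivAt (h i) (h (i + 1) s) s) →
    (∀ s ∈ Set.Icc (0 : ℝ) 1, |h d s - h d 0| ≤ C * s) →
    ∀ s ∈ Set.Icc (0 : ℝ) 1,
      |h 0 s - ∑ i ∈ Finset.range (d + 1), 1 / (i.factorial : ℝ) * h i 0 * s ^ i| ≤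
        C * s ^ (d + 1) / ((d + 1).factorial : ℝ) := by
  intro d
  induction d with
  | zero => intro h _ hC s hs; simpa using hC s hs
  | succ d ih =>
    intro h hder hC s hs
    have hsum : ∀ t : ℝ, HasDerivAt
        (fun s => ∑ i ∈ Finset.range (d + 1 + 1), 1 / (i.factorial : ℝ) * h i 0 * s ^ i)
        (∑ i ∈ Finset.range (d + 1), 1 / (i.factorial : ℝ) * h (i + 1) 0 * t ^ i) t := by
      intro t
      have h1 : HasDerivAt
          (fun s => ∑ i ∈ Finset.range (d + 1 + 1), 1 / (i.factorial : ℝ) * h i 0 * s ^ i)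
          (∑ i ∈ Finset.range (d + 1 + 1), 1 / (i.factorial : ℝ) * h i 0 * (i * t ^ (i - 1))) t :=
        HasDerivAt.fun_sum fun i _ => (hasDerivAt_pow i t).const_mul _
      convert h1 using 1
      rw [Finset.sum_range_succ' _ (d + 1)]
      simp only [Nat.cast_zero, zero_mul, mul_zero, add_zero, Nat.add_sub_cancel]
      refine Finset.sum_congr rfl fun i _ => ?_
      rw [Nat.factorial_succ]
      push_cast
      field_simp
    -- The derivative of the remainder is the remainder of the shifted chain `h (i + 1)`, bounded by
    -- induction; the bound is then integrated by comparison with `B`.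
    have hR : ∀ t : ℝ, HasDerivAt
        (fun s => h 0 s - ∑ i ∈ Finset.range (d + 1 + 1), 1 / (i.factorial : ℝ) * h i 0 * s ^ i)
        (h 1 t - ∑ i ∈ Finset.range (d + 1), 1 / (i.factorial : ℝ) * h (i + 1) 0 * t ^ i) t :=
      fun t => (hder 0 (Nat.succ_pos d) t).sub (hsum t)
    have hB : ∀ t : ℝ, HasDerivAt (fun s => C * s ^ (d + 1 + 1) / ((d + 1 + 1).factorial : ℝ))
        (C * t ^ (d + 1) / ((d + 1).factorial : ℝ)) t := by
      intro t
      refine (((hasDerivAt_pow (d + 1 + 1) t).const_mul C).div_const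
        ((d + 1 + 1).factorial : ℝ)).congr_deriv ?_
      rw [Nat.factorial_succ (d + 1)]
      push_cast
      field_simp
    have key := ih (fun i => h (i + 1)) (fun i hi s => hder (i + 1) (by omega) s) hC
    refine image_norm_le_of_norm_deriv_right_le_deriv_boundary
      (f := fun s => h 0 s - ∑ i ∈ Finset.range (d + 1 + 1), 1 / (i.factorial : ℝ) * h i 0 * s ^ i)
      (B := fun s => C * s ^ (d + 1 + 1) / ((d + 1 + 1).factorial : ℝ)) (a := 0) (b := 1)
      (fun t _ => (hR t).continuousAt.continuousWithinAt) (fun t _ => (hR t).hasDerivWithinAt) ?_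
      hB (fun t ht => key t ⟨ht.1, ht.2.le⟩) hs
    simp [Finset.sum_range_succ']

variable {E : Type*} [NormedAddCommGroup E] [NormedSpace ℝ E]

/-- The derivative along a line of the `i`-th directional derivative. -/
theorem hasDerivAt_iteratedFDeriv_line {f : E → ℝ} {d i : ℕ} (hf : ContDiff ℝ d f) (hi : i < d)
    (a v : E) (s : ℝ) :
    HasDerivAt (fun s : ℝ => iteratedFDeriv ℝ i f (a + s • v) fun _ => v)
      (iteratedFDeriv ℝ (i + 1) f (a + s • v) fun _ => v) s := by
  have h1 : HasFDerivAt (iteratedFDeriv ℝ i f) (fderiv ℝ (iteratedFDeriv ℝ i f) (a + s • v))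
      (a + s • v) :=
    (hf.differentiable_iteratedFDeriv (by exact_mod_cast hi) _).hasFDerivAt
  have h2 : HasDerivAt (fun s : ℝ => a + s • v) v s := by
    simpa using ((hasDerivAt_id s).smul_const v).const_add a
  have h3 := h1.comp_hasDerivAt s h2
  have h4 := (ContinuousMultilinearMap.apply ℝ (fun _ : Fin i => E) ℝ
    (fun _ => v)).hasFDerivAt.comp_hasDerivAt s h3
  exact h4

theorem hasDerivAt_line_one {f : E → ℝ} {d : ℕ} (hf : ContDiff ℝ d f) (hd : 1 ≤ d)
    (a v : E) (s : ℝ) :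
    HasDerivAt (fun s : ℝ => f (a + s • v)) (iteratedFDeriv ℝ 1 f (a + s • v) fun _ => v) s := by
  simpa using hasDerivAt_iteratedFDeriv_line hf hd a v s

theorem iteratedFDeriv_diagonal_sub_le {f : E → ℝ} {d : ℕ} {M : ℝ≥0}
    (hlip : LipschitzWith M (iteratedFDeriv ℝ d f)) (a v : E) {s : ℝ} (hs : 0 ≤ s) :
    |(iteratedFDeriv ℝ d f (a + s • v) fun _ => v) - iteratedFDeriv ℝ d f a fun _ => v| ≤
      M * ‖v‖ ^ (d + 1) * s := by
  have h1 := (iteratedFDeriv ℝ d f (a + s • v) - iteratedFDeriv ℝ d f a).le_opNorm (fun _ => v)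
  have h2 := hlip.norm_sub_le (a + s • v) a
  simp only [add_sub_cancel_left, norm_smul, Real.norm_eq_abs, abs_of_nonneg hs] at h2
  simp only [sub_apply, Finset.prod_const, Finset.card_univ,
    Fintype.card_fin] at h1
  calc _ ≤ _ := h1
    _ ≤ M * (s * ‖v‖) * ‖v‖ ^ d := by gcongr
    _ = _ := by ring

/-- Taylor's theorem for a function with Lipschitz `d`-th derivative. -/
theorem abs_sub_taylor_le_of_lipschitz {f : E → ℝ} {d : ℕ} {M : ℝ≥0} (hf : ContDiff ℝ d f)
    (hlip : LipschitzWith M (iteratedFDeriv ℝ d f)) (a v : E) :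
    |f (a + v) - ∑ i ∈ Finset.range (d + 1),
        1 / (i.factorial : ℝ) * iteratedFDeriv ℝ i f a fun _ => v| ≤
      M * ‖v‖ ^ (d + 1) / ((d + 1).factorial : ℝ) := by
  have := abs_sub_taylor_le (C := M * ‖v‖ ^ (d + 1)) d
    (fun i s => iteratedFDeriv ℝ i f (a + s • v) fun _ => v)
    (fun i hi s => hasDerivAt_iteratedFDeriv_line hf hi a v s)
    (fun s hs => by simpa using iteratedFDeriv_diagonal_sub_le hlip a v hs.1) 1 (by simp)
  simpa using this

/-- The Taylor remainder at `a` is Lipschitz, with constant of order `d` in the distance to `a`. -/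
theorem abs_taylor_remainder_sub_le {f : E → ℝ} {d : ℕ} {M : ℝ≥0} (hf : ContDiff ℝ d f)
    (hlip : LipschitzWith M (iteratedFDeriv ℝ d f)) (a v w : E) {ρ : ℝ} (hv : ‖v‖ ≤ ρ)
    (hw : ‖w‖ ≤ ρ) :
    |(f (a + v) - ∑ i ∈ Finset.range (d + 1),
        1 / (i.factorial : ℝ) * iteratedFDeriv ℝ i f a fun _ => v) -
      (f (a + w) - ∑ i ∈ Finset.range (d + 1),
        1 / (i.factorial : ℝ) * iteratedFDeriv ℝ i f a fun _ => w)| ≤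
      M * (d + 1) * ρ ^ d * ‖v - w‖ := by
  have hρ : 0 ≤ ρ := (norm_nonneg v).trans hv
  have hcd : ∀ u : E, ∀ i < d, ∀ s, HasDerivAt
      (fun s : ℝ => iteratedFDeriv ℝ i f (a + s • u) fun _ => u)
      (iteratedFDeriv ℝ (i + 1) f (a + s • u) fun _ => u) s :=
    fun u i hi s => hasDerivAt_iteratedFDeriv_line hf hi a u s
  -- The one-dimensional estimate is applied to the difference of the chains along `v` and `w`. The
  -- top difference splits in two: moving the base point costs `M ρ^d`, and changing the arguments
  -- of the multilinear form `A - A0` costs `M d ρ^d`, each times `s‖v - w‖`.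
  have hdiff : ∀ s ∈ Set.Icc (0 : ℝ) 1,
      |((iteratedFDeriv ℝ d f (a + s • v) fun _ => v) -
        (iteratedFDeriv ℝ d f (a + s • w) fun _ => w)) -
        ((iteratedFDeriv ℝ d f (a + (0 : ℝ) • v) fun _ => v) -
        (iteratedFDeriv ℝ d f (a + (0 : ℝ) • w) fun _ => w))| ≤
      M * (d + 1) * ρ ^ d * ‖v - w‖ * s := by
    intro s hs
    have hs0 := hs.1
    set A := iteratedFDeriv ℝ d f (a + s • v) with hA
    set B := iteratedFDeriv ℝ d f (a + s • w) with hB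
    set A0 := iteratedFDeriv ℝ d f a with hA0
    have h1 : ‖(A - B) fun _ => w‖ ≤ M * (s * ‖v - w‖) * ρ ^ d := by
      refine ((A - B).le_opNorm _).trans ?_
      have h2 := hlip.norm_sub_le (a + s • v) (a + s • w)
      rw [add_sub_add_left_eq_sub, ← smul_sub, norm_smul, Real.norm_eq_abs,
        abs_of_nonneg hs0] at h2
      simp only [Finset.prod_const, Finset.card_univ, Fintype.card_fin]
      gcongr
    have h2 : ‖((A - A0) fun _ => v) - ((A - A0) fun _ => w)‖ ≤
        M * (s * ρ) * d * ρ ^ (d - 1) * ‖v - w‖ := by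
      refine ((A - A0).norm_image_sub_le _ _).trans ?_
      have h3 := hlip.norm_sub_le (a + s • v) a
      rw [add_sub_cancel_left, norm_smul, Real.norm_eq_abs, abs_of_nonneg hs0] at h3
      have hcn : ∀ u : E, ‖fun _ : Fin d => u‖ ≤ ‖u‖ := fun u => pi_norm_const_le u
      have h4 : ‖A - A0‖ ≤ M * (s * ρ) := h3.trans (by gcongr)
      have h5 : max ‖fun _ : Fin d => v‖ ‖fun _ : Fin d => w‖ ≤ ρ :=
        max_le ((hcn v).trans hv) ((hcn w).trans hw)
      have h6 : ‖(fun _ : Fin d => v) - fun _ : Fin d => w‖ ≤ ‖v - w‖ := hcn (v - w)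
      simp only [Fintype.card_fin]
      gcongr
    have h3 : (d : ℝ) * (ρ * ρ ^ (d - 1)) = d * ρ ^ d := by
      rcases Nat.eq_zero_or_pos d with h | h
      · simp [h]
      · rw [mul_pow_sub_one h.ne']
    simp only [zero_smul, add_zero]
    calc |((A fun _ => v) - (B fun _ => w)) - ((A0 fun _ => v) - (A0 fun _ => w))|
        = |((A - B) fun _ => w) + (((A - A0) fun _ => v) - ((A - A0) fun _ => w))| := by
          congr 1
          simp only [sub_apply]
          ring
      _ ≤ M * (s * ‖v - w‖) * ρ ^ d + M * (s * ρ) * d * ρ ^ (d - 1) * ‖v - w‖ :=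
          (abs_add_le _ _).trans (add_le_add h1 h2)
      _ = M * (s * ‖v - w‖) * ρ ^ d + M * s * ‖v - w‖ * (d * (ρ * ρ ^ (d - 1))) := by ring
      _ = _ := by rw [h3]; ring
  have := abs_sub_taylor_le (C := M * (d + 1) * ρ ^ d * ‖v - w‖) d
    (fun i s => (iteratedFDeriv ℝ i f (a + s • v) fun _ => v) -
      (iteratedFDeriv ℝ i f (a + s • w) fun _ => w))
    (fun i hi s => (hcd v i hi s).sub (hcd w i hi s)) hdiff 1 (by simp)
  simp only [one_smul, zero_smul, add_zero, iteratedFDeriv_zero_apply, one_pow, mul_one, mul_sub,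
    Finset.sum_sub_distrib] at this
  refine (le_of_eq ?_).trans (this.trans (div_le_self (by positivity) ?_))
  · congr 1; ring
  · exact_mod_cast Nat.succ_le_of_lt (Nat.factorial_pos (d + 1))

theorem convexOn_univ_of_forall_line {g : E → ℝ}
    (h : ∀ a v : E, ConvexOn ℝ Set.univ fun s : ℝ => g (a + s • v)) : ConvexOn ℝ Set.univ g := by
  refine ⟨convex_univ, fun x _ y _ p q hp hq hpq => ?_⟩
  have := (h x (y - x)).2 (Set.mem_univ 0) (Set.mem_univ 1) hp hq hpq
  simp only [smul_eq_mul, mul_zero, zero_add, mul_one, zero_smul, add_zero, one_smul,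
    add_sub_cancel] at this
  have hxy : p • x + q • y = x + q • (y - x) := by
    rw [eq_sub_of_add_eq hpq]
    module
  rwa [hxy]

theorem convexOn_univ_of_hasDerivAt {g g' g'' : ℝ → ℝ} (h1 : ∀ s, HasDerivAt g (g' s) s)
    (h2 : ∀ s, HasDerivAt g' (g'' s) s) (h : ∀ s, 0 ≤ g'' s) : ConvexOn ℝ Set.univ g := by
  have e1 : deriv g = g' := funext fun s => (h1 s).deriv
  have e2 : deriv g' = g'' := funext fun s => (h2 s).deriv
  refine convexOn_univ_of_deriv2_nonneg (fun s => (h1 s).differentiableAt) ?_ ?_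
  · rw [e1]; exact fun s => (h2 s).differentiableAt
  · intro s; simp only [Function.iterate_succ, Function.iterate_zero, Function.comp_apply, id, e1,
      e2, h s]

theorem convexOn_univ_of_iteratedFDeriv_two_nonneg {f : E → ℝ} {d : ℕ} (hf : ContDiff ℝ d f)
    (hd : 2 ≤ d) (h : ∀ x v, 0 ≤ iteratedFDeriv ℝ 2 f x fun _ => v) : ConvexOn ℝ Set.univ f :=
  convexOn_univ_of_forall_line fun a v =>
    convexOn_univ_of_hasDerivAt (hasDerivAt_line_one hf (by omega) a v)
      (hasDerivAt_iteratedFDeriv_line hf (by omega) a v) fun _ => h _ _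

/-- Quadratic growth of a function at a minimizer. -/
theorem quadratic_growth_of_isMinOn {f : E → ℝ} {d : ℕ} (hf : ContDiff ℝ d f) (hd : 2 ≤ d)
    {K : Set E} (hK : Convex ℝ K) {μ : ℝ}
    (hμ : ∀ x ∈ K, ∀ v, μ * ‖v‖ ^ 2 ≤ iteratedFDeriv ℝ 2 f x fun _ => v) {x y : E} (hx : x ∈ K)
    (hy : y ∈ K) (hmin : ∀ z, f x ≤ f z) : μ / 2 * ‖y - x‖ ^ 2 ≤ f y - f x := by
  set v := y - x
  set g : ℝ → ℝ := fun s => f (x + s • v)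
  set g' : ℝ → ℝ := fun s => iteratedFDeriv ℝ 1 f (x + s • v) fun _ => v
  have h1 : ∀ s, HasDerivAt g (g' s) s := hasDerivAt_line_one hf (by omega) x v
  have h2 : ∀ s, HasDerivAt g' (iteratedFDeriv ℝ 2 f (x + s • v) fun _ => v) s :=
    hasDerivAt_iteratedFDeriv_line hf (by omega) x v
  have h0 : g' 0 = 0 := by
    have : IsLocalMin g 0 := Filter.Eventually.of_forall fun s => by simpa [g] using hmin _
    exact this.hasDerivAt_eq_zero (h1 0)
  have hmem : ∀ s ∈ Set.Icc (0 : ℝ) 1, x + s • v ∈ K := fun s hs =>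
    hK.add_smul_sub_mem hx hy hs
  -- The second derivative bound is integrated twice along the segment, starting from `g' 0 = 0` at
  -- the minimizer.
  have hg' : ∀ s ∈ Set.Icc (0 : ℝ) 1, μ * ‖v‖ ^ 2 * s ≤ g' s := by
    have hmono : MonotoneOn (fun s => g' s - μ * ‖v‖ ^ 2 * s) (Set.Icc 0 1) := by
      refine monotoneOn_of_hasDerivWithinAt_nonneg (convex_Icc 0 1)
        (f' := fun s => (iteratedFDeriv ℝ 2 f (x + s • v) fun _ => v) - μ * ‖v‖ ^ 2 * 1) ?_ ?_ ?_
      · exact fun s _ => ((h2 s).sub ((hasDerivAt_id s).const_mul _)).continuousAt.continuousWithinAt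
      · exact fun s _ => ((h2 s).sub ((hasDerivAt_id s).const_mul _)).hasDerivWithinAt
      · intro s hs
        rw [interior_Icc] at hs
        have := hμ _ (hmem s ⟨hs.1.le, hs.2.le⟩) v
        linarith
    intro s hs
    have := hmono (by simp) hs hs.1
    simp only [h0, mul_zero, sub_zero] at this
    linarith
  have hmono : MonotoneOn (fun s => g s - μ * ‖v‖ ^ 2 / 2 * s ^ 2) (Set.Icc 0 1) := by
    refine monotoneOn_of_hasDerivWithinAt_nonneg (convex_Icc 0 1)
      (f' := fun s => g' s - μ * ‖v‖ ^ 2 / 2 * ((2 : ℕ) * s ^ (2 - 1))) ?_ ?_ ?_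
    · exact fun s _ => ((h1 s).sub ((hasDerivAt_pow 2 s).const_mul _)).continuousAt.continuousWithinAt
    · exact fun s _ => ((h1 s).sub ((hasDerivAt_pow 2 s).const_mul _)).hasDerivWithinAt
    · intro s hs
      rw [interior_Icc] at hs
      have := hg' s ⟨hs.1.le, hs.2.le⟩
      simp only [Nat.cast_ofNat, Nat.add_one_sub_one, pow_one]
      linarith
  have := hmono (Set.left_mem_Icc.2 zero_le_one) (Set.right_mem_Icc.2 zero_le_one) zero_le_one
  simp only [g, v, zero_smul, one_smul, add_zero, add_sub_cancel, one_pow] at this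
  simp only [v]
  linarith

/-- A continuous family of positive definite quadratic forms is uniformly positive definite on
compact sets. -/
theorem exists_uniform_pos_def [FiniteDimensional ℝ E] {f : E → ℝ} {d : ℕ} (hf : ContDiff ℝ d f)
    (hd : 2 ≤ d) (hpos : ∀ x v : E, v ≠ 0 → 0 < iteratedFDeriv ℝ 2 f x fun _ => v) {K : Set E}
    (hK : IsCompact K) :
    ∃ μ : ℝ, 0 < μ ∧ ∀ x ∈ K, ∀ v, μ * ‖v‖ ^ 2 ≤ iteratedFDeriv ℝ 2 f x fun _ => v := by
  have hcomp : IsCompact (K ×ˢ Metric.sphere (0 : E) 1) := hK.prod (isCompact_sphere 0 1)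
  have hcont : Continuous fun p : E × E => iteratedFDeriv ℝ 2 f p.1 fun _ => p.2 := by
    have h2 := hf.continuous_iteratedFDeriv (m := 2) (by exact_mod_cast hd)
    have : Continuous fun p : E × E => (iteratedFDeriv ℝ 2 f p.1, fun _ : Fin 2 => p.2) := by
      fun_prop
    exact continuous_eval.comp this
  obtain ⟨μ, hμ, h⟩ : ∃ μ : ℝ, 0 < μ ∧ ∀ p ∈ K ×ˢ Metric.sphere (0 : E) 1,
      μ ≤ iteratedFDeriv ℝ 2 f p.1 fun _ => p.2 := by
    rcases (K ×ˢ Metric.sphere (0 : E) 1).eq_empty_or_nonempty with h | h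
    · exact ⟨1, one_pos, by simp [h]⟩
    · obtain ⟨p, hp, hmin⟩ := hcomp.exists_isMinOn h hcont.continuousOn
      refine ⟨_, hpos p.1 p.2 ?_, fun q hq => hmin hq⟩
      rintro h0
      have := hp.2
      simp [h0] at this
  refine ⟨μ, hμ, fun x hx v => ?_⟩
  rcases eq_or_ne v 0 with rfl | hv
  · rw [ContinuousMultilinearMap.map_coord_zero _ (0 : Fin 2) rfl]; simp
  · have hnv : ‖v‖ ≠ 0 := norm_ne_zero_iff.2 hv
    have h1 := h (x, ‖v‖⁻¹ • v) ⟨hx, by simp [norm_smul, hnv]⟩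
    have h2 : (iteratedFDeriv ℝ 2 f x fun _ => ‖v‖⁻¹ • v) =
        (‖v‖⁻¹) ^ 2 * iteratedFDeriv ℝ 2 f x fun _ => v := by
      rw [ContinuousMultilinearMap.map_smul_univ]; simp
    simp only [h2] at h1
    calc μ * ‖v‖ ^ 2 ≤ ((‖v‖⁻¹) ^ 2 * iteratedFDeriv ℝ 2 f x fun _ => v) * ‖v‖ ^ 2 := by gcongr
      _ = _ := by field_simp

end Calculus

/-! ### Absorbing intermediate terms by sums of squares. -/

section SumsOfSquares

variable {A : Type*} [CommRing A]

theorem IsSumSq.of_eq {p q : A} (hp : IsSumSq p) (h : q = p) : IsSumSq q := h ▸ hp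

theorem IsSumSq.pow {p : A} (hp : IsSumSq p) (k : ℕ) : IsSumSq (p ^ k) := by
  induction k with
  | zero => simp
  | succ k ih => rw [pow_succ]; exact ih.mul hp

theorem IsSumSq.map_ringHom {B C : Type*} [CommRing B] [CommRing C] (φ : B →+* C) {p : B}
    (hp : IsSumSq p) : IsSumSq (φ p) := by
  induction hp with
  | zero => simp
  | sq_add a _ ih => rw [map_add, map_mul]; exact (IsSumSq.mul_self _).add ih

theorem isSumSq_sq (p : A) : IsSumSq (p ^ 2) := by rw [sq]; exact IsSumSq.mul_self p

theorem isSumSq_one_add_pow_sub_pow {s : A} (hs : IsSumSq s) {j N : ℕ} (hj : j ≤ N) :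
    IsSumSq (1 + s ^ N - s ^ j) := by
  obtain ⟨k, rfl⟩ := Nat.exists_eq_add_of_le hj
  have h1 := mul_geom_sum s j
  have h2 := mul_geom_sum s k
  -- The left side is `(s^j - 1)(s^k - 1) + s^k`, and both factors are divisible by `s - 1`.
  have : 1 + s ^ (j + k) - s ^ j =
      (s - 1) ^ 2 * ((∑ i ∈ Finset.range j, s ^ i) * ∑ i ∈ Finset.range k, s ^ i) + s ^ k := by
    linear_combination (-(s - 1) * ∑ i ∈ Finset.range k, s ^ i) * h1 - (s ^ j - 1) * h2
  rw [this]
  exact ((isSumSq_sq _).mul ((IsSumSq.sum fun i _ => hs.pow i).mul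
    (IsSumSq.sum fun i _ => hs.pow i))).add (hs.pow k)

variable [Algebra ℝ A]

theorem IsSumSq.smul_nonneg {p : A} (hp : IsSumSq p) {c : ℝ} (hc : 0 ≤ c) : IsSumSq (c • p) := by
  have : c • p = algebraMap ℝ A (√c) * algebraMap ℝ A (√c) * p := by
    rw [← map_mul, Real.mul_self_sqrt hc, Algebra.smul_def]
  rw [this]
  exact (IsSumSq.mul_self _).mul hp

theorem exists_isSumSq_absorb_pow {s : A} (hs : IsSumSq s) {N : ℕ} : ∀ (k j : ℕ), j + k = N →
    1 ≤ j → ∀ ε : ℝ, 0 < ε → ∃ t : ℝ, 0 ≤ t ∧ IsSumSq (ε • (1 : A) + t • s ^ N - s ^ j) := by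
  intro k
  induction k with
  | zero =>
    rintro j rfl - ε hε
    refine ⟨1, zero_le_one, ?_⟩
    simpa using (IsSumSq.one (R := A)).smul_nonneg hε.le
  | succ k ih =>
    intro j hjk hj ε hε
    obtain ⟨t', ht', h'⟩ := ih (j + 1) (by omega) (by omega) (ε ^ 2) (by positivity)
    obtain ⟨j, rfl⟩ := Nat.exists_eq_add_of_le' hj
    -- Since `2ab = 1`, the square `s^j (a - b s)²` bounds `s^(j+1)` by `a² s^j + b² s^(j+2)`. The
    -- constants left by the two terms are `a² = ε/2` and `b² ε² = ε/2`.
    set a := √(ε / 2)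
    set b := (2 * a)⁻¹
    have ha : 0 < a := Real.sqrt_pos.2 (by positivity)
    have ha2 : a ^ 2 = ε / 2 := Real.sq_sqrt (by positivity)
    have hab : 2 * a * b = 1 := mul_inv_cancel₀ (by positivity)
    have hb2 : b ^ 2 = 1 / (2 * ε) := by
      simp only [b, inv_pow, mul_pow, ha2]; field_simp
    have hε' : ε = a ^ 2 + b ^ 2 * ε ^ 2 := by rw [ha2, hb2]; field_simp; norm_num
    have hab' : 2 * algebraMap ℝ A a * algebraMap ℝ A b = 1 := by
      rw [← map_ofNat (algebraMap ℝ A) 2, ← map_mul, ← map_mul, hab, map_one]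
    refine ⟨a ^ 2 + b ^ 2 * t', by positivity, ?_⟩
    have h1 := ((hs.pow j).mul (isSumSq_sq (algebraMap ℝ A a - algebraMap ℝ A b * s))).add
      (((isSumSq_one_add_pow_sub_pow hs (show j ≤ N by omega)).smul_nonneg (sq_nonneg a)).add
        (h'.smul_nonneg (sq_nonneg b)))
    have hsplit : ε • (1 : A) = (a ^ 2 + b ^ 2 * ε ^ 2) • (1 : A) := by rw [← hε']
    rw [hsplit]
    refine IsSumSq.of_eq (h1) ?_
    simp only [Algebra.smul_def, map_add, map_mul, map_pow]
    linear_combination s ^ (j + 1) * hab'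

/-- `S` is a sum of squares that dominates, up to constants, the square of every element of `V`. -/
def SOSDominates (V : Submodule ℝ A) (S : A) : Prop :=
  IsSumSq S ∧ ∀ v ∈ V, ∃ C : ℝ, 0 < C ∧ IsSumSq (C • S - v ^ 2)

theorem sosDominates_span {ι : Type*} [Fintype ι] (u : ι → A) :
    SOSDominates (Submodule.span ℝ (Set.range u)) (∑ i, u i ^ 2) := by
  classical
  have hS : IsSumSq (∑ i, u i ^ 2) := IsSumSq.sum_sq _ _
  refine ⟨hS, fun v hv => ?_⟩
  induction hv using Submodule.span_induction with
  | mem x hx =>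
    obtain ⟨i, rfl⟩ := hx
    refine ⟨1, one_pos, ?_⟩
    rw [one_smul, ← Finset.add_sum_erase _ _ (Finset.mem_univ i), add_sub_cancel_left]
    exact IsSumSq.sum_sq _ _
  | zero => exact ⟨1, one_pos, by simp [hS]⟩
  | add x y _ _ hx hy =>
    obtain ⟨C, hC, h1⟩ := hx
    obtain ⟨C', hC', h2⟩ := hy
    refine ⟨2 * C + 2 * C', by positivity, ?_⟩
    refine IsSumSq.of_eq ((isSumSq_sq (x - y)).add ((h1.smul_nonneg zero_le_two).add
      (h2.smul_nonneg zero_le_two))) ?_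
    simp only [Algebra.smul_def, map_add, map_mul, map_ofNat]
    ring
  | smul c x _ hx =>
    obtain ⟨C, hC, h1⟩ := hx
    refine ⟨(c ^ 2 + 1) * C, by positivity, ?_⟩
    refine IsSumSq.of_eq ((h1.smul_nonneg (sq_nonneg c)).add (hS.smul_nonneg hC.le)) ?_
    simp only [Algebra.smul_def, map_add, map_mul, map_pow, map_one]
    ring

theorem SOSDominates.mul {V W : Submodule ℝ A} {S T : A} (hV : SOSDominates V S)
    (hW : SOSDominates W T) : SOSDominates (V * W) (S * T) := by
  refine ⟨hV.1.mul hW.1, fun v hv => ?_⟩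
  induction hv using Submodule.mul_induction_on' with
  | mem_mul_mem x hx y hy =>
    obtain ⟨C, hC, h1⟩ := hV.2 x hx
    obtain ⟨C', hC', h2⟩ := hW.2 y hy
    refine ⟨C * C', by positivity, ?_⟩
    refine IsSumSq.of_eq ((h1.mul (hW.1.smul_nonneg hC'.le)).add ((isSumSq_sq x).mul h2)) ?_
    simp only [Algebra.smul_def, map_mul]
    ring
  | add x _ y _ hx hy =>
    obtain ⟨C, hC, h1⟩ := hx
    obtain ⟨C', hC', h2⟩ := hy
    refine ⟨2 * C + 2 * C', by positivity, ?_⟩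
    refine IsSumSq.of_eq ((isSumSq_sq (x - y)).add ((h1.smul_nonneg zero_le_two).add
      (h2.smul_nonneg zero_le_two))) ?_
    simp only [Algebra.smul_def, map_add, map_mul, map_ofNat]
    ring

theorem sosDominates_one : SOSDominates (1 : Submodule ℝ A) 1 := by
  refine ⟨IsSumSq.one, fun v hv => ?_⟩
  obtain ⟨c, rfl⟩ := Submodule.mem_one.1 hv
  refine ⟨c ^ 2 + 1, by positivity, ?_⟩
  refine IsSumSq.of_eq (IsSumSq.one (R := A)) ?_
  simp [Algebra.smul_def]

theorem SOSDominates.pow {V : Submodule ℝ A} {S : A} (hV : SOSDominates V S) (k : ℕ) :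
    SOSDominates (V ^ k) (S ^ k) := by
  induction k with
  | zero => simpa using sosDominates_one
  | succ k ih => rw [pow_succ, pow_succ]; exact ih.mul hV

/-- Terms `y y' ∏ u` of total degree in `u` strictly between `0` and `2 N` are absorbed by
`ε |y|² + t |y|² |u|^{2 N}`. -/
theorem exists_isSumSq_absorb {Y U : Submodule ℝ A} {r s : A} (hY : SOSDominates Y r)
    (hU : SOSDominates U s) {k N : ℕ} (hk : 1 ≤ k) (hkN : k < 2 * N) {P : A}
    (hP : P ∈ Y * Y * U ^ k) {ε : ℝ} (hε : 0 < ε) :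
    ∃ t : ℝ, 0 ≤ t ∧ IsSumSq (ε • r + t • (r * s ^ N) + P) := by
  -- The upper half `k - k/2` is at least `1` and at most `N`, so its power of `s` can be absorbed
  -- with an arbitrarily small constant. The lower half may be `0`, so its smallness has to come
  -- from the weight `a`.
  have hsplit : Y * Y * U ^ k = (Y * U ^ (k / 2)) * (Y * U ^ (k - k / 2)) := by
    rw [mul_mul_mul_comm, ← pow_add]
    congr 2
    omega
  rw [hsplit] at hP
  have hi : k / 2 ≤ N := by omega
  have hj : k - k / 2 ≤ N := by omega
  have hj1 : 1 ≤ k - k / 2 := by omega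
  generalize k / 2 = i at *
  generalize k - i = j at *
  induction hP using Submodule.mul_induction_on' generalizing ε with
  | mem_mul_mem v hv w hw =>
    obtain ⟨C₁, hC₁, h1⟩ := (hY.mul (hU.pow i)).2 v hv
    obtain ⟨C₂, hC₂, h2⟩ := (hY.mul (hU.pow j)).2 w hw
    -- With `2ab = 1` the product `v w` completes to `(a v + b w)²`. The term in `v` uses `a² C₁ =
    -- ε/2`; the tolerance for `s^j` is chosen so that the term in `w` uses the other `ε/2`.
    set a := √(ε / (2 * C₁))
    set b := (2 * a)⁻¹
    have ha : 0 < a := Real.sqrt_pos.2 (by positivity)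
    have ha2 : a ^ 2 = ε / (2 * C₁) := Real.sq_sqrt (by positivity)
    have hab : 2 * a * b = 1 := mul_inv_cancel₀ (by positivity)
    have hb : 0 < b := by positivity
    have hab' : 2 * algebraMap ℝ A a * algebraMap ℝ A b = 1 := by
      rw [← map_ofNat (algebraMap ℝ A) 2, ← map_mul, ← map_mul, hab, map_one]
    obtain ⟨t', ht', h3⟩ := exists_isSumSq_absorb_pow hU.1 (N := N) (N - j) j (by omega) hj1
      (ε / 2 / (b ^ 2 * C₂)) (by positivity)
    have hε' : ε = a ^ 2 * C₁ + b ^ 2 * C₂ * (ε / 2 / (b ^ 2 * C₂)) := by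
      rw [ha2]; field_simp; norm_num
    have hsp : ε • r = (a ^ 2 * C₁ + b ^ 2 * C₂ * (ε / 2 / (b ^ 2 * C₂))) • r := by rw [← hε']
    generalize ε / 2 / (b ^ 2 * C₂) = ε' at h3 hsp
    refine ⟨a ^ 2 * C₁ + b ^ 2 * C₂ * t', by positivity, ?_⟩
    have h4 := (isSumSq_sq (algebraMap ℝ A a * v + algebraMap ℝ A b * w)).add
      ((h1.smul_nonneg (sq_nonneg a)).add ((h2.smul_nonneg (sq_nonneg b)).add
        (((hY.1.mul (isSumSq_one_add_pow_sub_pow hU.1 hi)).smul_nonneg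
          (c := a ^ 2 * C₁) (by positivity)).add
          ((hY.1.mul h3).smul_nonneg (c := b ^ 2 * C₂) (by positivity)))))
    rw [hsp]
    refine IsSumSq.of_eq (h4) ?_
    simp only [Algebra.smul_def, map_add, map_mul, map_pow]
    linear_combination (-v * w) * hab'
  | add x _ y _ hx hy =>
    obtain ⟨t, ht, h1⟩ := hx (half_pos hε)
    obtain ⟨t', ht', h2⟩ := hy (half_pos hε)
    refine ⟨t + t', by positivity, ?_⟩
    refine IsSumSq.of_eq (h1.add h2) ?_
    have : ε • r = (ε / 2) • r + (ε / 2) • r := by rw [← add_smul, add_halves]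
    rw [this, add_smul]
    ring

/-- Absorbing the two extreme coefficients `±2B` suffices: every admissible `c` is a convex
combination of them, and sums of squares form a convex cone. -/
theorem exists_isSumSq_absorb_smul {r s P : A} {N : ℕ} (hr : IsSumSq r) (hs : IsSumSq s)
    (hP : ∀ c ε : ℝ, 0 < ε → ∃ t : ℝ, 0 ≤ t ∧ IsSumSq (ε • r + t • (r * s ^ N) + c • P)) {B : ℝ}
    (hB : 0 < B) {ε : ℝ} (hε : 0 < ε) :
    ∃ t : ℝ, 0 ≤ t ∧ ∀ c : ℝ, |c| ≤ B → IsSumSq (ε • r + t • (r * s ^ N) + c • P) := by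
  obtain ⟨t, ht, h1⟩ := hP (2 * B) ε hε
  obtain ⟨t', ht', h2⟩ := hP (-(2 * B)) ε hε
  refine ⟨t + t', by positivity, fun c hc => ?_⟩
  obtain ⟨hc1, hc2⟩ := abs_le.1 hc
  set l := (c + 2 * B) / (4 * B)
  have hl : 0 ≤ l := by have : 0 ≤ c + 2 * B := by linarith
                        positivity
  have hl1 : l ≤ 1 := by rw [div_le_one (by positivity)]; linarith
  have hlc : c = l * (2 * B) + (1 - l) * -(2 * B) := by simp only [l]; field_simp; ring
  refine IsSumSq.of_eq (((h1.smul_nonneg hl).add (h2.smul_nonneg (sub_nonneg.2 hl1))).add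
    ((hr.mul (hs.pow N)).smul_nonneg (c := (1 - l) * t + l * t')
      (by have := sub_nonneg.2 hl1; positivity))) ?_
  have : c • P = (l * (2 * B) + (1 - l) * -(2 * B)) • P := by rw [← hlc]
  rw [this]
  module

/-- A finite family of absorbable terms is absorbed uniformly over bounded coefficients. -/
theorem exists_isSumSq_absorb_sum {ι : Type*} {r s : A} {N : ℕ} (hr : IsSumSq r) (hs : IsSumSq s)
    (I : Finset ι) (P : ι → A)
    (hP : ∀ i ∈ I, ∀ c ε : ℝ, 0 < ε →
      ∃ t : ℝ, 0 ≤ t ∧ IsSumSq (ε • r + t • (r * s ^ N) + c • P i)) {B : ℝ} (hB : 0 < B) :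
    ∀ ε : ℝ, 0 < ε → ∃ t : ℝ, 0 ≤ t ∧ ∀ c : ι → ℝ, (∀ i ∈ I, |c i| ≤ B) →
      IsSumSq (ε • r + t • (r * s ^ N) + ∑ i ∈ I, c i • P i) := by
  classical
  induction I using Finset.induction_on with
  | empty => exact fun ε hε => ⟨0, le_rfl, fun c _ => by simpa using hr.smul_nonneg hε.le⟩
  | insert i I hi ih =>
    intro ε hε
    obtain ⟨t, ht, h1⟩ := ih (fun i hi' => hP i (Finset.mem_insert_of_mem hi')) (ε / 2)
      (half_pos hε)
    obtain ⟨t', ht', h2⟩ := exists_isSumSq_absorb_smul hr hs (hP i (Finset.mem_insert_self i I)) hB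
      (half_pos hε)
    refine ⟨t + t', by positivity, fun c hc => ?_⟩
    refine IsSumSq.of_eq ((h1 c fun k hk => hc k (Finset.mem_insert_of_mem hk)).add
      (h2 (c i) (hc i (Finset.mem_insert_self i I)))) ?_
    have : ε • r = (ε / 2) • r + (ε / 2) • r := by rw [← add_smul, add_halves]
    rw [this, add_smul, Finset.sum_insert hi]
    ring

theorem sum_symmetrize_smul {n : ℕ} (c : Fin n → Fin n → ℝ) (y : Fin n → A) :
    ∑ i, ∑ j, ((c i j + c j i) / 2) • (y i * y j) = ∑ i, ∑ j, c i j • (y i * y j) := by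
  have h1 : ∑ i, ∑ j, c j i • (y i * y j) = ∑ i, ∑ j, c i j • (y i * y j) := by
    rw [Finset.sum_comm]
    simp only [mul_comm]
  have h2 : ∑ i, ∑ j, ((c i j + c j i) / 2) • (y i * y j) = (1 / 2 : ℝ) •
      (∑ i, ∑ j, c i j • (y i * y j) + ∑ i, ∑ j, c j i • (y i * y j)) := by
    simp only [Finset.smul_sum, ← Finset.sum_add_distrib]
    refine Finset.sum_congr rfl fun i _ => Finset.sum_congr rfl fun j _ => ?_
    module
  rw [h2, h1]
  module

/-- A positive semidefinite quadratic form is a sum of squares. -/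
theorem isSumSq_quadratic {n : ℕ} (c : Fin n → Fin n → ℝ)
    (hc : ∀ v : Fin n → ℝ, 0 ≤ ∑ i, ∑ j, c i j * (v i * v j)) (y : Fin n → A) :
    IsSumSq (∑ i, ∑ j, c i j • (y i * y j)) := by
  -- The coefficients need not be symmetric, so the spectral decomposition is applied to the
  -- symmetric part, which has the same quadratic form.
  let Q : Matrix (Fin n) (Fin n) ℝ := Matrix.of fun i j => (c i j + c j i) / 2
  have hQ : Q.PosSemidef := by
    refine Matrix.PosSemidef.of_dotProduct_mulVec_nonneg ?_ fun v => ?_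
    · ext i j
      simp [Q, add_comm]
    · refine (hc v).trans_eq ((sum_symmetrize_smul c v).symm.trans ?_)
      simp only [dotProduct, Matrix.mulVec, Finset.mul_sum, Q, Matrix.of_apply, smul_eq_mul]
      refine Finset.sum_congr rfl fun i _ => Finset.sum_congr rfl fun j _ => ?_
      simp
      ring
  obtain ⟨m, w, hw⟩ := Matrix.posSemidef_iff_eq_sum_vecMulVec.1 hQ
  have hQw : ∀ i j, (c i j + c j i) / 2 = ∑ k, w k i * w k j := fun i j => by
    have := congr_fun (congr_fun hw i) j
    simpa [Q, Matrix.sum_apply, Matrix.vecMulVec_apply] using this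
  refine IsSumSq.of_eq (IsSumSq.sum_sq Finset.univ fun k => ∑ i, w k i • y i) ?_
  rw [← sum_symmetrize_smul]
  simp only [hQw, sq, Finset.sum_mul_sum, Finset.sum_smul, smul_mul_smul_comm]
  rw [Finset.sum_congr rfl fun i _ => Finset.sum_comm, Finset.sum_comm]

variable {Y U : Submodule ℝ A}

theorem Submodule.prod_mem_pow_fin : ∀ (k : ℕ) (g : Fin k → A), (∀ j, g j ∈ U) →
    ∏ j, g j ∈ U ^ k := by
  intro k
  induction k with
  | zero => intro g _; simpa using Submodule.one_le.1 (le_refl (1 : Submodule ℝ A))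
  | succ k ih =>
    intro g hg
    rw [Fin.prod_univ_succ, pow_succ']
    exact Submodule.mul_mem_mul (hg 0) (ih _ fun j => hg j.succ)

/-- Degree bookkeeping by the Leibniz rule: `D` trades one factor from `U` for one from `Y`. -/
theorem Derivation.map_mem_mul_pow (D : Derivation ℝ A A) (hU : ∀ u ∈ U, D u ∈ Y) :
    ∀ (k : ℕ) {P : A}, P ∈ U ^ (k + 1) → D P ∈ Y * U ^ k := by
  intro k
  induction k with
  | zero => intro P hP; simpa using hU P (by simpa using hP)
  | succ k ih =>
    intro P hP
    rw [pow_succ'] at hP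
    induction hP using Submodule.mul_induction_on' with
    | mem_mul_mem u hu w hw =>
      rw [D.leibniz, smul_eq_mul, smul_eq_mul]
      refine add_mem ?_ ?_
      · rw [pow_succ', ← mul_assoc, mul_comm Y U, mul_assoc]
        exact Submodule.mul_mem_mul hu (ih hw)
      · rw [mul_comm w]
        exact Submodule.mul_mem_mul (hU u hu) hw
    | add x _ y _ hx hy => rw [map_add]; exact add_mem hx hy

theorem Derivation.map_map_mem_mul_pow (D : Derivation ℝ A A) (hU : ∀ u ∈ U, D u ∈ Y)
    (hY : ∀ y ∈ Y, D y = 0) (k : ℕ) {P : A} (hP : P ∈ U ^ (k + 2)) :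
    D (D P) ∈ Y * Y * U ^ k := by
  have h := D.map_mem_mul_pow hU (k + 1) hP
  generalize D P = Q at h
  induction h using Submodule.mul_induction_on' with
  | mem_mul_mem y hy w hw =>
    rw [D.leibniz, hY y hy, smul_zero, add_zero, smul_eq_mul, mul_assoc]
    exact Submodule.mul_mem_mul hy (D.map_mem_mul_pow hU k hw)
  | add x _ y _ hx hy => rw [map_add]; exact add_mem hx hy

end SumsOfSquares

/-! ### The Hessian form as a second derivation, and the model as a polynomial. -/

section Polynomials

open MvPolynomial

variable {n : ℕ}

/-- The derivation of `ℝ[x, y]` with `xᵢ ↦ yᵢ` and `yᵢ ↦ 0`. -/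
noncomputable def dirDeriv (n : ℕ) :
    Derivation ℝ (MvPolynomial (Fin n ⊕ Fin n) ℝ) (MvPolynomial (Fin n ⊕ Fin n) ℝ) :=
  mkDerivation ℝ (Sum.elim (fun i => X (Sum.inr i)) 0)

@[simp] theorem dirDeriv_X_inl (i : Fin n) : dirDeriv n (X (Sum.inl i)) = X (Sum.inr i) := by
  simp [dirDeriv]

@[simp] theorem dirDeriv_X_inr (i : Fin n) : dirDeriv n (X (Sum.inr i)) = 0 := by
  simp [dirDeriv]

theorem dirDeriv_rename (p : MvPolynomial (Fin n) ℝ) :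
    dirDeriv n (rename Sum.inl p) = ∑ i, X (Sum.inr i) * rename Sum.inl (pderiv i p) := by
  induction p using MvPolynomial.induction_on with
  | C c => simp
  | add p q hp hq => simp [hp, hq, mul_add, Finset.sum_add_distrib]
  | mul_X p j hp =>
    simp only [map_mul, rename_X, Derivation.leibniz, dirDeriv_X_inl, hp, smul_eq_mul, pderiv_X,
      map_add, mul_add, Finset.sum_add_distrib, Finset.mul_sum]
    congr 1
    · rw [Finset.sum_eq_single j]
      · simp [mul_comm]
      · intro i _ hij
        simp [Pi.single_eq_of_ne' hij]
      · simp
    · refine Finset.sum_congr rfl fun i _ => ?_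
      ring

theorem hessianForm_eq_dirDeriv (p : MvPolynomial (Fin n) ℝ) :
    hessianForm p = dirDeriv n (dirDeriv n (rename Sum.inl p)) := by
  simp only [dirDeriv_rename, map_sum, Derivation.leibniz, dirDeriv_X_inr, smul_eq_mul,
    mul_zero, add_zero, Finset.mul_sum, hessianForm]
  rw [Finset.sum_comm]
  refine Finset.sum_congr rfl fun i _ => Finset.sum_congr rfl fun j _ => ?_
  ring

/-- Under evaluation at `(x + s v, v)` the derivation becomes `d/ds`; it suffices to check this on
the variables. -/
theorem hasDerivAt_eval_line (x v : Fin n → ℝ) (P : MvPolynomial (Fin n ⊕ Fin n) ℝ) (s : ℝ) :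
    HasDerivAt (fun s => eval (Sum.elim (fun i => x i + s * v i) v) P)
      (eval (Sum.elim (fun i => x i + s * v i) v) (dirDeriv n P)) s := by
  induction P using MvPolynomial.induction_on with
  | C c => simpa using hasDerivAt_const s c
  | add p q hp hq => simp only [map_add]; exact hp.add hq
  | mul_X p j hp =>
    have hj : HasDerivAt (fun s => eval (Sum.elim (fun i => x i + s * v i) v) (X j))
        (eval (Sum.elim (fun i => x i + s * v i) v) (dirDeriv n (X j))) s := by
      rcases j with j | j
      · simpa using ((hasDerivAt_id s).mul_const (v j)).const_add (x j)
      · simpa using hasDerivAt_const s (v j)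
    have := hp.mul hj
    simp only [map_mul, Derivation.leibniz, smul_eq_mul, map_add]
    refine this.congr_deriv ?_
    ring

theorem IsSOSConvex.convexOn {g : RSpace n → ℝ} (hg : IsSOSConvex g) :
    ConvexOn ℝ Set.univ g := by
  obtain ⟨p, hp, hsos⟩ := hg
  rw [hessianForm_eq_dirDeriv] at hsos
  refine convexOn_univ_of_forall_line fun a v => ?_
  have hline : (fun s : ℝ => g (a + s • v)) =
      fun s => eval (Sum.elim (fun i => a i + s * v i) v) (rename Sum.inl p) := by
    funext s
    rw [← hp, eval_rename]
    rfl
  rw [hline]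
  exact convexOn_univ_of_hasDerivAt (hasDerivAt_eval_line a v _) (hasDerivAt_eval_line a v _)
    fun s => (hsos.map_ringHom (eval _)).nonneg

/-- Translation of the `x`-variables. -/
noncomputable def shiftX (a : Fin n → ℝ) :
    MvPolynomial (Fin n ⊕ Fin n) ℝ →ₐ[ℝ] MvPolynomial (Fin n ⊕ Fin n) ℝ :=
  aeval (Sum.elim (fun i => X (Sum.inl i) - C (a i)) fun i => X (Sum.inr i))

theorem dirDeriv_shiftX (a : Fin n → ℝ) (P : MvPolynomial (Fin n ⊕ Fin n) ℝ) :
    dirDeriv n (shiftX a P) = shiftX a (dirDeriv n P) := by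
  induction P using MvPolynomial.induction_on with
  | C c => simp [shiftX, algebraMap_eq]
  | add p q hp hq => simp [hp, hq]
  | mul_X p j hp =>
    have hj : dirDeriv n (shiftX a (X j)) = shiftX a (dirDeriv n (X j)) := by
      rcases j with j | j <;> simp [shiftX]
    simp [Derivation.leibniz, hp, hj]

/-- Translation commutes with `D`, so sos-convexity may be tested with the center moved to the
origin. -/
theorem hessianForm_aeval_sub (a : Fin n → ℝ) (p : MvPolynomial (Fin n) ℝ) :
    hessianForm (aeval (fun i => X i - C (a i)) p) = shiftX a (hessianForm p) := by
  have : rename Sum.inl (aeval (fun i => X i - C (a i)) p) = shiftX a (rename Sum.inl p) := by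
    rw [shiftX, aeval_rename, ← AlgHom.comp_apply, comp_aeval]
    congr 2
    funext i
    simp
  rw [hessianForm_eq_dirDeriv, hessianForm_eq_dirDeriv, this, dirDeriv_shiftX, dirDeriv_shiftX]

/-- The polynomial with coefficients `c i r` at the ordered monomials `∏ j, X (r j)` of degree
`i ≤ d`, plus `t` times the `m`-th power of the squared norm. -/
noncomputable def modelPoly (d m : ℕ) (c : (i : ℕ) → (Fin i → Fin n) → ℝ) (t : ℝ) :
    MvPolynomial (Fin n) ℝ :=
  ∑ i ∈ Finset.range (d + 1), ∑ r : Fin i → Fin n, c i r • ∏ j, X (r j) +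
    t • (∑ i, X i ^ 2) ^ m

theorem multilinear_diagonal_expand {i : ℕ}
    (L : ContinuousMultilinearMap ℝ (fun _ : Fin i => RSpace n) ℝ) (v : RSpace n) :
    (L fun _ => v) = ∑ r : Fin i → Fin n,
      (L fun j => EuclideanSpace.single (r j) (1 : ℝ)) * ∏ j, v (r j) := by
  have hv : v = ∑ k, v k • EuclideanSpace.single k (1 : ℝ) := by
    ext j
    simp [Finset.sum_apply, Pi.single_apply]
  conv_lhs => rw [hv]
  rw [L.map_sum (fun _ k => v k • EuclideanSpace.single k (1 : ℝ))]
  refine Finset.sum_congr rfl fun r _ => ?_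
  rw [L.map_smul_univ (fun j => v (r j)), smul_eq_mul, mul_comm]

/-- The coefficients of the Taylor expansion. -/
noncomputable def taylorCoeff (f : RSpace n → ℝ) (a : RSpace n) (i : ℕ) (r : Fin i → Fin n) : ℝ :=
  1 / (i.factorial : ℝ) * iteratedFDeriv ℝ i f a fun j => EuclideanSpace.single (r j) (1 : ℝ)

theorem eval_modelPoly (f : RSpace n → ℝ) (d : ℕ) (a : RSpace n) (t : ℝ) (x : RSpace n) :
    eval (fun i => x i) (aeval (fun i => X i - C (a i))
      (modelPoly d (d / 2 + 1) (taylorCoeff f a) t)) =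
      taylorExpansion f d a x + t * ‖x - a‖ ^ nextEven d := by
  have h1 : ∀ p : MvPolynomial (Fin n) ℝ,
      eval (fun i => x i) (aeval (fun i => X i - C (a i)) p) = eval (fun i => (x - a) i) p := by
    intro p
    induction p using MvPolynomial.induction_on with
    | C c => simp [algebraMap_eq]
    | add p q hp hq => rw [map_add, map_add, map_add, hp, hq]
    | mul_X p j hp => rw [map_mul, map_mul, map_mul, hp]; simp
  rw [h1, modelPoly, taylorExpansion]
  have hn : ‖x - a‖ ^ nextEven d = (∑ i, (x - a) i ^ 2) ^ (d / 2 + 1) := by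
    rw [nextEven, pow_mul, EuclideanSpace.real_norm_sq_eq]
  rw [hn]
  simp only [map_add, map_sum, smul_eval, map_prod, map_pow, eval_X]
  congr 1
  refine Finset.sum_congr rfl fun i _ => ?_
  rw [multilinear_diagonal_expand, Finset.mul_sum]
  refine Finset.sum_congr rfl fun r _ => ?_
  rw [taylorCoeff, mul_assoc]

/-- The squared norm of the `x`-variables. -/
noncomputable def sqX (n : ℕ) : MvPolynomial (Fin n ⊕ Fin n) ℝ := ∑ i, X (Sum.inl i) ^ 2

/-- The squared norm of the `y`-variables. -/
noncomputable def sqY (n : ℕ) : MvPolynomial (Fin n ⊕ Fin n) ℝ := ∑ i, X (Sum.inr i) ^ 2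

theorem isSumSq_sqX : IsSumSq (sqX n) := IsSumSq.sum_sq _ _

theorem isSumSq_sqY : IsSumSq (sqY n) := IsSumSq.sum_sq _ _

/-- The second derivative of `|x|^{2(N+1)}` in direction `y` dominates `|y|² |x|^{2N}`. -/
theorem isSumSq_dirDeriv_sqX_pow (N : ℕ) :
    IsSumSq (dirDeriv n (dirDeriv n (sqX n ^ (N + 1))) - sqY n * sqX n ^ N) := by
  set z : MvPolynomial (Fin n ⊕ Fin n) ℝ := ∑ i, X (Sum.inl i) * X (Sum.inr i) with hz
  have h1 : dirDeriv n (sqX n) = 2 * z := by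
    simp only [sqX, hz, map_sum, Derivation.leibniz_pow, dirDeriv_X_inl, Finset.mul_sum]
    refine Finset.sum_congr rfl fun i _ => ?_
    simp
  have h2 : dirDeriv n z = sqY n := by
    simp only [sqY, hz, map_sum, Derivation.leibniz, dirDeriv_X_inl, dirDeriv_X_inr]
    refine Finset.sum_congr rfl fun i _ => ?_
    simp
    ring
  have h3 : dirDeriv n (2 * z) = 2 * sqY n := by
    rw [two_mul, map_add, h2, two_mul]
  have h4 : dirDeriv n (dirDeriv n (sqX n ^ (N + 1))) =
      ((N + 1 : ℕ) : MvPolynomial (Fin n ⊕ Fin n) ℝ) * (sqX n ^ N * (2 * sqY n) +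
        (2 * z) * (N * sqX n ^ (N - 1) * (2 * z))) := by
    rw [Derivation.leibniz_pow, h1, Nat.add_sub_cancel, map_nsmul, smul_eq_mul,
      Derivation.leibniz, Derivation.leibniz_pow, h1, h3]
    simp only [smul_eq_mul, nsmul_eq_mul]
    ring
  have hnat := fun k : ℕ => IsSumSq.natCast (R := MvPolynomial (Fin n ⊕ Fin n) ℝ) k
  -- Writing `r`, `s` for the squared norms of `y`, `x`, the difference is `(2N+1) r s^N + (N+1) N
  -- s^(N-1) (2z)²`. For `N = 0` the truncated exponent is harmless, as its coefficient vanishes.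
  refine IsSumSq.of_eq (((hnat (2 * N + 1)).mul (isSumSq_sqY.mul (isSumSq_sqX.pow N))).add
    (((hnat (N + 1)).mul (hnat N)).mul ((isSumSq_sqX.pow (N - 1)).mul (isSumSq_sq (2 * z))))) ?_
  rw [h4]
  push_cast
  ring

/-- Degrees `0` and `1` are killed by `D²`, degree `2` gives a form in `y` alone, and the degrees
from `3` on, indexed from `0`, are those to be absorbed. -/
theorem hessianForm_modelPoly (d m : ℕ) (hd : 3 ≤ d)
    (c : (i : ℕ) → (Fin i → Fin n) → ℝ) (t : ℝ) :
    hessianForm (modelPoly d m c t) =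
      ∑ p ∈ (Finset.range (d - 2)).sigma (fun i => (Finset.univ : Finset (Fin (i + 3) → Fin n))),
        c (p.1 + 3) p.2 • dirDeriv n (dirDeriv n (∏ j, X (Sum.inl (p.2 j)))) +
      ∑ i, ∑ j, (2 * c 2 ![i, j]) • (X (Sum.inr i) * X (Sum.inr j)) +
      t • dirDeriv n (dirDeriv n (sqX n ^ m)) := by
  rw [hessianForm_eq_dirDeriv, modelPoly, show d + 1 = (d - 2) + 1 + 1 + 1 by omega,
    Finset.sum_range_succ', Finset.sum_range_succ', Finset.sum_range_succ', Finset.sum_sigma]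
  simp only [map_add, map_sum, map_smul, Derivation.map_smul, map_prod, map_pow, rename_X]
  have h0 : ∀ r : Fin 0 → Fin n, dirDeriv n (dirDeriv n (∏ j, X (Sum.inl (r j)))) = 0 := by
    intro r; simp
  have h1 : ∀ r : Fin (0 + 1) → Fin n, dirDeriv n (dirDeriv n (∏ j, X (Sum.inl (r j)))) = 0 := by
    intro r; simp
  have h2 : ∑ r : Fin (0 + 1 + 1) → Fin n,
      c (0 + 1 + 1) r • dirDeriv n (dirDeriv n (∏ j, X (Sum.inl (r j)))) =
      ∑ i, ∑ j, (2 * c 2 ![i, j]) • (X (Sum.inr i) * X (Sum.inr j)) := by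
    rw [← Fintype.sum_prod_type', ← (finTwoArrowEquiv (Fin n)).symm.sum_comp]
    refine Finset.sum_congr rfl fun p _ => ?_
    simp [Fin.prod_univ_two, Derivation.leibniz, mul_smul, smul_comm (2 : ℝ)]
    rw [← smul_add]
    congr 1
    rw [two_smul]
    ring
  simp only [h0, h1, h2, smul_zero, Finset.sum_const_zero, add_zero]
  rfl

end Polynomials

/-! ### Uniform feasibility of the program. -/

section Feasibility

open MvPolynomial

variable {n : ℕ}

/-- The program is feasible, uniformly over compact sets. -/
theorem exists_uniform_feasible {f : RSpace n → ℝ} {d : ℕ} (hd : Odd d) (hd3 : 3 ≤ d)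
    (hf : ContDiff ℝ d f)
    (hpos : ∀ x v : RSpace n, v ≠ 0 → 0 < iteratedFDeriv ℝ 2 f x fun _ => v)
    {K : Set (RSpace n)} (hK : IsCompact K) : ∃ t : ℝ, ∀ a ∈ K, t ∈ feasibleReg f d a := by
  obtain ⟨μ, hμ, hμK⟩ := exists_uniform_pos_def hf (by omega) hpos hK
  set I := (Finset.range (d - 2)).sigma
    (fun i => (Finset.univ : Finset (Fin (i + 3) → Fin n))) with hI
  obtain ⟨B, hB⟩ := hK.exists_bound_of_continuousOn
    (f := fun a => ∑ p ∈ I, |taylorCoeff f a (p.1 + 3) p.2|) (by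
      refine Continuous.continuousOn (continuous_finsetSum _ fun p hp => ?_)
      have hpd : p.1 + 3 ≤ d := by
        have := (Finset.mem_sigma.1 hp).1
        simp at this; omega
      have := hf.continuous_iteratedFDeriv (m := p.1 + 3) (by exact_mod_cast hpd)
      unfold taylorCoeff
      exact (continuous_const.mul (continuous_eval_const _ |>.comp this)).abs)
  have hdom : ∀ q ∈ I, ∀ c ε : ℝ, 0 < ε → ∃ t : ℝ, 0 ≤ t ∧
      IsSumSq (ε • sqY n + t • (sqY n * sqX n ^ (d / 2)) +
        c • dirDeriv n (dirDeriv n (∏ j, X (Sum.inl (q.2 j))))) := by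
    intro q hq c ε hε
    have hqd : q.1 < d - 2 := Finset.mem_range.1 (Finset.mem_sigma.1 hq).1
    have hd2 : d = 2 * (d / 2) + 1 := by obtain ⟨k, rfl⟩ := hd; omega
    set U := Submodule.span ℝ (Set.range fun i : Fin n =>
      (X (Sum.inl i) : MvPolynomial (Fin n ⊕ Fin n) ℝ))
    set Y := Submodule.span ℝ (Set.range fun i : Fin n =>
      (X (Sum.inr i) : MvPolynomial (Fin n ⊕ Fin n) ℝ))
    have hU : ∀ u ∈ U, dirDeriv n u ∈ Y := by
      intro u hu
      induction hu using Submodule.span_induction with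
      | mem x hx => 
        obtain ⟨i, rfl⟩ := hx
        rw [dirDeriv_X_inl]
        exact Submodule.subset_span ⟨i, rfl⟩
      | zero => simp
      | add x y _ _ hx hy => rw [map_add]; exact add_mem hx hy
      | smul c x _ hx => rw [Derivation.map_smul]; exact Submodule.smul_mem _ _ hx
    have hY : ∀ y ∈ Y, dirDeriv n y = 0 := by
      intro y hy
      induction hy using Submodule.span_induction with
      | mem x hx => obtain ⟨i, rfl⟩ := hx; simp
      | zero => simp
      | add x y _ _ hx hy => rw [map_add, hx, hy, add_zero]
      | smul c x _ hx => rw [Derivation.map_smul, hx, smul_zero]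
    have hprod : ∏ j, X (Sum.inl (q.2 j)) ∈ U ^ (q.1 + 1 + 2) :=
      Submodule.prod_mem_pow_fin _ _ fun j => Submodule.subset_span ⟨q.2 j, rfl⟩
    exact exists_isSumSq_absorb (sosDominates_span _) (sosDominates_span _) (by omega) (by omega)
      (Submodule.smul_mem _ c ((dirDeriv n).map_map_mem_mul_pow hU hY (q.1 + 1) hprod)) hε
  obtain ⟨t, ht, htB⟩ := exists_isSumSq_absorb_sum isSumSq_sqY isSumSq_sqX I _ hdom
    (B := max B 1) (by positivity) μ hμ
  refine ⟨t, fun a ha => ⟨ht, _, eval_modelPoly f d a t, ?_⟩⟩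
  rw [hessianForm_aeval_sub]
  refine IsSumSq.map_ringHom (shiftX fun i => a i).toRingHom ?_
  rw [hessianForm_modelPoly _ _ hd3]
  have h1 := htB (fun p => taylorCoeff f a (p.1 + 3) p.2) fun p hp => by
    refine le_trans ?_ (le_max_left _ _)
    refine le_trans ?_ ((le_abs_self _).trans (hB a ha))
    exact Finset.single_le_sum (f := fun p : (i : ℕ) × (Fin (i + 3) → Fin n) =>
      |taylorCoeff f a (p.1 + 3) p.2|) (fun p _ => abs_nonneg _) hp
  -- The `μ|y|²` removed here from the Hessian at `a` is the `ε|y|²` spent on absorbing the higher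
  -- terms.
  have h2 : IsSumSq (∑ i, ∑ j, (2 * taylorCoeff f a 2 ![i, j] - if i = j then μ else 0) •
      ((X (Sum.inr i) : MvPolynomial (Fin n ⊕ Fin n) ℝ) * X (Sum.inr j))) := by
    refine isSumSq_quadratic _ (fun v => ?_) _
    have h3 := hμK a ha (WithLp.toLp 2 v)
    rw [multilinear_diagonal_expand, EuclideanSpace.real_norm_sq_eq,
      ← (finTwoArrowEquiv (Fin n)).symm.sum_comp, Fintype.sum_prod_type] at h3
    simp only [sub_mul, Finset.sum_sub_distrib, ite_mul, zero_mul, Finset.sum_ite_eq,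
      Finset.mem_univ, if_true]
    rw [sub_nonneg, ← Finset.mul_sum]
    refine (le_of_eq ?_).trans (h3.trans (le_of_eq ?_))
    · simp [sq]
    · refine Finset.sum_congr rfl fun i _ => Finset.sum_congr rfl fun j _ => ?_
      simp [taylorCoeff, Fin.prod_univ_two]
  have h3 := (isSumSq_dirDeriv_sqX_pow (n := n) (d / 2)).smul_nonneg ht
  refine IsSumSq.of_eq (h1.add (h2.add h3)) ?_
  have h4 : ∑ i, ∑ j, (if i = j then μ else 0) •
      ((X (Sum.inr i) : MvPolynomial (Fin n ⊕ Fin n) ℝ) * X (Sum.inr j)) = μ • sqY n := by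
    simp [sqY, Finset.smul_sum, sq]
  simp only [sub_smul, Finset.sum_sub_distrib, h4, smul_sub]
  abel

end Feasibility

/-! ### Convexity of the model and its unique minimizer. -/

section Model

variable {n : ℕ}

theorem nextEven_of_odd {d : ℕ} (hd : Odd d) : nextEven d = d + 1 := by
  obtain ⟨k, rfl⟩ := hd
  rw [nextEven]
  omega

theorem optReg_le {f : RSpace n → ℝ} {d : ℕ} {a : RSpace n} {t : ℝ} (ht : t ∈ feasibleReg f d a) :
    optReg f d a ≤ t :=
  csInf_le ⟨0, fun _ h => h.1⟩ ht

theorem convexOn_norm_sub_pow (a : RSpace n) (k : ℕ) :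
    ConvexOn ℝ Set.univ fun x : RSpace n => ‖x - a‖ ^ k := by
  have := (convexOn_univ_dist a).pow (fun x _ => dist_nonneg) k
  simp only [dist_eq_norm] at this
  exact this

/-- The infimum `t(a)` itself already makes the model convex. -/
theorem convexOn_model {f : RSpace n → ℝ} {d : ℕ} {a : RSpace n}
    (hfeas : (feasibleReg f d a).Nonempty) {σ : ℝ} (hσ : optReg f d a ≤ σ) :
    ConvexOn ℝ Set.univ fun x => taylorExpansion f d a x + σ * ‖x - a‖ ^ nextEven d := by
  -- Above the infimum there is a feasible `t' < t`, and the excess is a nonnegative multiple of a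
  -- convex function. Convexity then passes to the limit `t ↓ σ`.
  have hgt : ∀ t, σ < t →
      ConvexOn ℝ Set.univ fun x => taylorExpansion f d a x + t * ‖x - a‖ ^ nextEven d := by
    intro t ht
    obtain ⟨t', ht', htt'⟩ := exists_lt_of_csInf_lt hfeas (hσ.trans_lt ht)
    have h := ht'.2.convexOn.add
      ((convexOn_norm_sub_pow a (nextEven d)).smul (sub_nonneg.2 htt'.le))
    refine h.congr fun x _ => ?_
    simp only [Pi.add_apply, smul_eq_mul]
    ring
  refine ⟨convex_univ, fun x hx y hy p q hp hq hpq => ?_⟩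
  refine ContinuousWithinAt.closure_le (s := Set.Ioi σ) (x := σ)
    (f := fun t => taylorExpansion f d a (p • x + q • y) + t * ‖p • x + q • y - a‖ ^ nextEven d)
    (g := fun t => p • (taylorExpansion f d a x + t * ‖x - a‖ ^ nextEven d) +
      q • (taylorExpansion f d a y + t * ‖y - a‖ ^ nextEven d)) ?_ ?_ ?_ ?_
  · rw [closure_Ioi]; exact Set.self_mem_Ici
  · exact Continuous.continuousWithinAt (by fun_prop)
  · exact Continuous.continuousWithinAt (by fun_prop)
  · exact fun t ht => (hgt t ht).2 hx hy hp hq hpq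

/-- A convex polynomial with nonzero second derivative is unbounded above on every half-line. -/
theorem Polynomial.exists_eval_gt_of_convexOn {q : Polynomial ℝ}
    (hconv : ConvexOn ℝ Set.univ fun s => q.eval s) (h2 : q.coeff 2 ≠ 0) :
    ∃ s : ℝ, 0 ≤ s ∧ q.eval 0 < q.eval s := by
  by_contra! hle
  -- Convexity between `-1`, `0` and `s` gives a linear lower bound. With the assumed upper bound,
  -- `q` grows at most linearly, so its degree is below `2`.
  have hlow : ∀ s : ℝ, 0 ≤ s → (1 + s) * q.eval 0 - s * q.eval (-1) ≤ q.eval s := by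
    intro s hs
    have h := hconv.2 (Set.mem_univ (-1)) (Set.mem_univ s)
      (show 0 ≤ s / (1 + s) by positivity) (show 0 ≤ 1 / (1 + s) by positivity)
      (by field_simp; ring)
    have h0 : (s / (1 + s)) • (-1 : ℝ) + (1 / (1 + s)) • s = 0 := by
      simp only [smul_eq_mul]; ring
    simp only [smul_eq_mul] at h h0
    rw [h0] at h
    have h1 : (1 + s) * q.eval 0 ≤
        (1 + s) * (s / (1 + s) * q.eval (-1) + 1 / (1 + s) * q.eval s) :=
      mul_le_mul_of_nonneg_left h (by positivity)
    have h3 : (1 + s) * (s / (1 + s) * q.eval (-1) + 1 / (1 + s) * q.eval s) =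
        s * q.eval (-1) + q.eval s := by field_simp
    linarith
  have hdeg : q.degree < (Polynomial.X ^ 2 : Polynomial ℝ).degree := by
    rw [← Polynomial.div_tendsto_atTop_zero_iff_degree_lt q _ (by simp)]
    refine squeeze_zero_norm' (a := fun s => (|q.eval 0| * 2 + |q.eval (-1)|) * s⁻¹) ?_ ?_
    · filter_upwards [Filter.eventually_ge_atTop 1] with s hs
      have hs0 : 0 < s := by linarith
      rw [Polynomial.eval_pow, Polynomial.eval_X, norm_div, Real.norm_eq_abs, Real.norm_eq_abs,
        abs_of_pos (pow_pos hs0 2), div_le_iff₀ (pow_pos hs0 2)]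
      have e : (|q.eval 0| * 2 + |q.eval (-1)|) * s⁻¹ * s ^ 2 =
        (|q.eval 0| * 2 + |q.eval (-1)|) * s := by field_simp
      rw [e, abs_le]
      have a1 := neg_abs_le (q.eval 0)
      have a2 := le_abs_self (q.eval 0)
      have a3 := le_abs_self (q.eval (-1))
      have a4 := abs_nonneg (q.eval (-1))
      constructor
      · have := hlow s hs0.le
        nlinarith
      · have := hle s hs0.le
        nlinarith
    · simpa using tendsto_inv_atTop_zero.const_mul (|q.eval 0| * 2 + |q.eval (-1)|)
  rw [Polynomial.degree_X_pow] at hdeg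
  exact h2 (Polynomial.coeff_eq_zero_of_degree_lt hdeg)

/-- A convex function that is unbounded above along every half-line from `a` has bounded
sublevel sets at the level of `a`. -/
theorem isBounded_sublevel_of_convexOn {ψ : RSpace n → ℝ} {a : RSpace n}
    (hconv : ConvexOn ℝ Set.univ ψ) (hcont : Continuous ψ)
    (hray : ∀ v : RSpace n, v ≠ 0 → ∃ s : ℝ, 0 ≤ s ∧ ψ a < ψ (a + s • v)) :
    Bornology.IsBounded {x | ψ x ≤ ψ a} := by
  by_contra hb
  have hx : ∀ k : ℕ, ∃ x, ψ x ≤ ψ a ∧ (k : ℝ) < ‖x - a‖ := by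
    intro k
    by_contra! h
    refine hb ((Metric.isBounded_closedBall (x := a) (r := k)).subset fun x hx => ?_)
    rw [Metric.mem_closedBall, dist_eq_norm]
    exact h x hx
  choose x hxψ hxk using hx
  have hpos : ∀ k, 0 < ‖x k - a‖ := fun k => (Nat.cast_nonneg k).trans_lt (hxk k)
  -- Recession direction: for fixed `s`, the point at distance `s` from `a` towards a far `x k` lies
  -- in the convex sublevel set, hence so does the limit `a + s • v`.
  obtain ⟨v, hv, φ, hφ, hlim⟩ := (isCompact_sphere (0 : RSpace n) 1).tendsto_subseq
    (x := fun k => ‖x k - a‖⁻¹ • (x k - a))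
    fun k => by simp [norm_smul, (hpos k).ne']
  have hv0 : v ≠ 0 := by
    rintro rfl
    simp at hv
  obtain ⟨s, hs, hsv⟩ := hray v hv0
  refine hsv.not_ge (le_of_tendsto (((hcont.tendsto _).comp
    ((hlim.const_smul s).const_add a))) ?_)
  filter_upwards [Filter.eventually_ge_atTop ⌈s⌉₊] with k hk
  have hsk : s ≤ ‖x (φ k) - a‖ :=
    (Nat.le_ceil s).trans ((Nat.cast_le.2 (hk.trans (hφ.id_le k))).trans (hxk _).le)
  have hp := hpos (φ k)
  have hl1 : s * ‖x (φ k) - a‖⁻¹ ≤ 1 := by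
    rw [← div_eq_mul_inv, div_le_one hp]
    exact hsk
  have h := (hconv.convex_le (ψ a)).add_smul_sub_mem (x := a) (y := x (φ k))
    ⟨Set.mem_univ _, le_rfl⟩ ⟨Set.mem_univ _, hxψ _⟩
    (t := s * ‖x (φ k) - a‖⁻¹) ⟨by positivity, hl1⟩
  simpa [smul_smul] using h.2

/-- Two minimizers make `ψ` constant on their segment, hence on the whole line, `ψ` being polynomial
there. A convex function bounded above along one line cannot rise in that direction from any other
point, which contradicts `hray`. -/
theorem existsUnique_isGlobalMinimizer {ψ : RSpace n → ℝ} {a : RSpace n}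
    (hconv : ConvexOn ℝ Set.univ ψ) (hcont : Continuous ψ)
    (hline : ∀ y v : RSpace n, ∃ q : Polynomial ℝ, ∀ s : ℝ, ψ (y + s • v) = q.eval s)
    (hray : ∀ v : RSpace n, v ≠ 0 → ∃ s : ℝ, 0 ≤ s ∧ ψ a < ψ (a + s • v)) :
    ∃! y, IsGlobalMinimizer ψ y := by
  have hcomp : IsCompact {x | ψ x ≤ ψ a} :=
    Metric.isCompact_of_isClosed_isBounded (isClosed_le hcont continuous_const)
      (isBounded_sublevel_of_convexOn hconv hcont hray)
  obtain ⟨y, hy, hmin⟩ := hcomp.exists_isMinOn ⟨a, le_refl (ψ a)⟩ hcont.continuousOn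
  have hyg : IsGlobalMinimizer ψ y := by
    intro z
    rcases le_or_gt (ψ z) (ψ a) with h | h
    · exact hmin h
    · exact le_trans hy h.le
  refine ⟨y, hyg, fun z hz => ?_⟩
  by_contra hne
  obtain ⟨q, hq⟩ := hline y (z - y)
  have hzy : ψ z = ψ y := le_antisymm (hz y) (hyg z)
  have hconst : ∀ s : ℝ, ψ (y + s • (z - y)) = ψ y := by
    have : q = Polynomial.C (ψ y) := by
      refine Polynomial.eq_of_infinite_eval_eq _ _
        ((Set.Icc_infinite (zero_lt_one (α := ℝ))).mono fun s hs => ?_)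
      simp only [Set.mem_ofPred_eq, ← hq, Polynomial.eval_C]
      refine le_antisymm ?_ (hyg _)
      exact ((hconv.convex_le (ψ y)).add_smul_sub_mem ⟨Set.mem_univ _, le_rfl⟩
        ⟨Set.mem_univ _, hzy.le⟩ hs).2
    intro s
    rw [hq, this, Polynomial.eval_C]
  obtain ⟨s, -, hs⟩ := hray (z - y) (sub_ne_zero.2 hne)
  -- The points are combinations of `a` with a point of the constant line that recedes as `l → 0`;
  -- the limit gives `ψ (a + s • (z - y)) ≤ ψ a`.
  have hlam : ∀ l ∈ Set.Ioc (0 : ℝ) 1,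
      ψ (a + s • (z - y) + l • (y - a)) ≤ (1 - l) * ψ a + l * ψ y := by
    intro l hl
    have h := hconv.2 (Set.mem_univ a) (Set.mem_univ (y + (s / l) • (z - y)))
      (sub_nonneg.2 hl.2) hl.1.le (by ring)
    rw [hconst] at h
    have e : (1 - l) • a + l • (y + (s / l) • (z - y)) = a + s • (z - y) + l • (y - a) := by
      rw [smul_add, smul_smul, mul_div_cancel₀ _ hl.1.ne']
      module
    rwa [e] at h
  have := ContinuousWithinAt.closure_le (s := Set.Ioc (0 : ℝ) 1) (x := 0)
    (f := fun l => ψ (a + s • (z - y) + l • (y - a))) (g := fun l => (1 - l) * ψ a + l * ψ y)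
    (by rw [closure_Ioc zero_ne_one]; simp)
    (Continuous.continuousWithinAt (by fun_prop)) (Continuous.continuousWithinAt (by fun_prop)) hlam
  simp only [zero_smul, add_zero, sub_zero, one_mul, zero_mul] at this
  exact hs.not_ge this

theorem continuous_taylorExpansion (f : RSpace n → ℝ) (d : ℕ) (a : RSpace n) :
    Continuous (taylorExpansion f d a) := by
  unfold taylorExpansion
  refine continuous_finsetSum _ fun i _ => continuous_const.mul ?_
  exact (iteratedFDeriv ℝ i f a).cont.comp (by fun_prop)

theorem exists_polynomial_line (f : RSpace n → ℝ) (d : ℕ) (a : RSpace n) (σ : ℝ)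
    (y v : RSpace n) : ∃ q : Polynomial ℝ, ∀ s : ℝ,
      taylorExpansion f d a (y + s • v) + σ * ‖y + s • v - a‖ ^ nextEven d = q.eval s := by
  obtain ⟨p, hp⟩ : ∃ p : MvPolynomial (Fin n) ℝ, ∀ x : RSpace n,
      MvPolynomial.eval (fun i => x i) p = taylorExpansion f d a x + σ * ‖x - a‖ ^ nextEven d :=
    ⟨_, eval_modelPoly f d a σ⟩
  refine ⟨MvPolynomial.aeval (fun i => Polynomial.C (y i) + Polynomial.C (v i) * Polynomial.X) p,
    fun s => ?_⟩
  rw [← hp]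
  clear hp
  induction p using MvPolynomial.induction_on with
  | C c => simp
  | add p q hp hq => simp only [map_add, Polynomial.eval_add, hp, hq]
  | mul_X p j hp =>
    simp only [map_mul, Polynomial.eval_mul, hp, MvPolynomial.eval_X, MvPolynomial.aeval_X]
    simp [mul_comm s]

theorem coeff_two_of_model_line {f : RSpace n → ℝ} {d k : ℕ} (hd : 2 ≤ d) (hk : 1 < k)
    {a v : RSpace n} {σ : ℝ} {q : Polynomial ℝ}
    (hq : ∀ s : ℝ, taylorExpansion f d a (a + s • v) + σ * ‖a + s • v - a‖ ^ (2 * k) = q.eval s) :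
    q.coeff 2 = 1 / 2 * iteratedFDeriv ℝ 2 f a fun _ => v := by
  have : q = ∑ i ∈ Finset.range (d + 1),
      Polynomial.C (1 / (i.factorial : ℝ) * iteratedFDeriv ℝ i f a fun _ => v) * Polynomial.X ^ i +
      Polynomial.C (σ * ‖v‖ ^ (2 * k)) * Polynomial.X ^ (2 * k) := by
    refine Polynomial.funext fun s => ?_
    rw [← hq, taylorExpansion, Polynomial.eval_add, Polynomial.eval_finsetSum]
    simp only [add_sub_cancel_left, norm_smul, mul_pow, Real.norm_eq_abs, pow_mul, sq_abs,
      Polynomial.eval_mul, Polynomial.eval_C, Polynomial.eval_pow, Polynomial.eval_X]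
    congr 1
    · refine Finset.sum_congr rfl fun i _ => ?_
      rw [ContinuousMultilinearMap.map_smul_univ _ (fun _ => s) fun _ => v]
      simp
      ring
    · ring
  rw [this]
  simp only [Polynomial.coeff_add, Polynomial.finsetSum_coeff, Polynomial.coeff_C_mul,
    Polynomial.coeff_X_pow]
  rw [Finset.sum_eq_single 2]
  · simp [show 2 ≠ 2 * k by omega]
  · intro i _ hi; simp [hi.symm]
  · intro h; simp at h; omega

/-- A regularized model with admissible regularization parameter has a unique minimizer. -/
theorem existsUnique_globalModel_minimizer {f : RSpace n → ℝ} {d : ℕ} (hd : Odd d) (hd3 : 3 ≤ d)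
    (M : ℝ) {a : RSpace n} (hpos : ∀ v : RSpace n, v ≠ 0 → 0 < iteratedFDeriv ℝ 2 f a fun _ => v)
    (hfeas : (feasibleReg f d a).Nonempty) :
    ∃! y, IsGlobalMinimizer (globalModel f d M a) y := by
  set σ := max ((d : ℝ) * M / ((d + 1).factorial : ℝ)) (optReg f d a)
  have hψ : globalModel f d M a =
      fun x => taylorExpansion f d a x + σ * ‖x - a‖ ^ nextEven d := by
    rw [nextEven_of_odd hd]; rfl
  have hconv := convexOn_model hfeas (σ := σ) (le_max_right _ _)
  have hline := exists_polynomial_line f d a σ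
  rw [hψ]
  refine existsUnique_isGlobalMinimizer (a := a) hconv ?_ hline fun v hv => ?_
  · have := continuous_taylorExpansion f d a
    fun_prop
  · obtain ⟨q, hq⟩ := hline a v
    have hc := coeff_two_of_model_line (by omega) (k := d / 2 + 1) (by omega) hq
    have hqc : ConvexOn ℝ Set.univ fun s => q.eval s := by
      have h1 : (fun s => q.eval s) = (fun x => taylorExpansion f d a x +
          σ * ‖x - a‖ ^ nextEven d) ∘ AffineMap.lineMap a (a + v) := by
        funext s
        rw [← hq, Function.comp_apply, AffineMap.lineMap_apply_module']
        simp [add_comm]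
      rw [h1]
      exact hconv.comp_affineMap _
    obtain ⟨s, hs, h⟩ := Polynomial.exists_eval_gt_of_convexOn hqc
      (by rw [hc]; have := hpos v hv; positivity)
    refine ⟨s, hs, ?_⟩
    rw [← hq, ← hq, zero_smul, add_zero] at h
    exact h

end Model

/-! ### Global rate and local order. -/

section Convergence

variable {n : ℕ}

theorem abs_norm_pow_sub_norm_pow_le {v w : RSpace n} {ρ : ℝ} (hv : ‖v‖ ≤ ρ) (hw : ‖w‖ ≤ ρ)
    (d : ℕ) : |‖v‖ ^ (d + 1) - ‖w‖ ^ (d + 1)| ≤ (d + 1) * ρ ^ d * ‖v - w‖ := by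
  refine (abs_pow_sub_pow_le _ _ _).trans ?_
  have h1 : max |‖v‖| |‖w‖| ≤ ρ := by simpa using ⟨hv, hw⟩
  have h2 := abs_norm_sub_norm_le v w
  have h3 : 0 ≤ max |‖v‖| |‖w‖| := (abs_nonneg _).trans (le_max_left _ _)
  rw [Nat.add_sub_cancel]
  calc |‖v‖ - ‖w‖| * ((d + 1 : ℕ) : ℝ) * max |‖v‖| |‖w‖| ^ d
      ≤ ‖v - w‖ * ((d + 1 : ℕ) : ℝ) * ρ ^ d := by gcongr
    _ = _ := by push_cast; ring

variable {f : RSpace n → ℝ} {d : ℕ} {M : ℝ≥0}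

theorem abs_sub_taylorExpansion_le (hf : ContDiff ℝ d f)
    (hlip : LipschitzWith M (iteratedFDeriv ℝ d f)) (a x : RSpace n) :
    |f x - taylorExpansion f d a x| ≤ M * ‖x - a‖ ^ (d + 1) / ((d + 1).factorial : ℝ) := by
  simpa [taylorExpansion] using abs_sub_taylor_le_of_lipschitz hf hlip a (x - a)

/-- The regularization parameter of the model. -/
noncomputable def regParam (f : RSpace n → ℝ) (d : ℕ) (M : ℝ) (a : RSpace n) : ℝ :=
  max ((d : ℝ) * M / ((d + 1).factorial : ℝ)) (optReg f d a)

theorem globalModel_eq (f : RSpace n → ℝ) (d : ℕ) (M : ℝ) (a x : RSpace n) :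
    globalModel f d M a x = taylorExpansion f d a x + regParam f d M a * ‖x - a‖ ^ (d + 1) := rfl

theorem regParam_nonneg (f : RSpace n → ℝ) (d : ℕ) (M : ℝ≥0) (a : RSpace n) :
    0 ≤ regParam f d M a :=
  le_trans (by positivity) (le_max_left _ _)

theorem le_globalModel (hf : ContDiff ℝ d f) (hd : 1 ≤ d)
    (hlip : LipschitzWith M (iteratedFDeriv ℝ d f)) (a x : RSpace n) :
    f x ≤ globalModel f d M a x := by
  have h1 := (le_abs_self _).trans (abs_sub_taylorExpansion_le hf hlip a x)
  have h2 : M * ‖x - a‖ ^ (d + 1) / ((d + 1).factorial : ℝ) ≤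
      regParam f d M a * ‖x - a‖ ^ (d + 1) := by
    rw [mul_div_right_comm]
    gcongr
    refine le_trans ?_ (le_max_left _ _)
    gcongr
    exact le_mul_of_one_le_left M.2 (by exact_mod_cast hd)
  rw [globalModel_eq]
  linarith

theorem globalModel_le (hf : ContDiff ℝ d f) (hlip : LipschitzWith M (iteratedFDeriv ℝ d f))
    (a x : RSpace n) {S : ℝ} (hS : regParam f d M a ≤ S) :
    globalModel f d M a x ≤ f x + (M + S) * ‖x - a‖ ^ (d + 1) := by
  have h1 := (neg_le_abs _).trans (abs_sub_taylorExpansion_le hf hlip a x)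
  have h2 : M * ‖x - a‖ ^ (d + 1) / ((d + 1).factorial : ℝ) ≤ M * ‖x - a‖ ^ (d + 1) :=
    div_le_self (by positivity) (by exact_mod_cast Nat.succ_le_of_lt (Nat.factorial_pos (d + 1)))
  have h3 : regParam f d M a * ‖x - a‖ ^ (d + 1) ≤ S * ‖x - a‖ ^ (d + 1) := by gcongr
  rw [globalModel_eq]
  linarith

/-- One step decreases `f` at least as much as a proximal step with the power `d + 1`. -/
theorem step_le (hf : ContDiff ℝ d f) (hd : 1 ≤ d)
    (hlip : LipschitzWith M (iteratedFDeriv ℝ d f)) {a y : RSpace n}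
    (hy : IsGlobalMinimizer (globalModel f d M a) y) {S : ℝ} (hS : regParam f d M a ≤ S)
    (z : RSpace n) : f y ≤ f z + (M + S) * ‖z - a‖ ^ (d + 1) :=
  (le_globalModel hf hd hlip a y).trans ((hy z).trans (globalModel_le hf hlip a z hS))

theorem step_decreasing (hf : ContDiff ℝ d f) (hd : 1 ≤ d)
    (hlip : LipschitzWith M (iteratedFDeriv ℝ d f)) {a y : RSpace n}
    (hy : IsGlobalMinimizer (globalModel f d M a) y) : f y ≤ f a := by
  simpa using step_le hf hd hlip hy le_rfl a

/-- A bound `O(ρ^(d+1))` on the error itself would yield only local order `(d+1)/2`; the extra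
factor `‖y - x‖` is what gives order `d`. -/
theorem abs_model_error_sub_le (hf : ContDiff ℝ d f)
    (hlip : LipschitzWith M (iteratedFDeriv ℝ d f)) {a x y : RSpace n} {S : ℝ}
    (hS : regParam f d M a ≤ S) {ρ : ℝ} (hx : ‖x - a‖ ≤ ρ) (hy : ‖y - a‖ ≤ ρ) :
    |(f y - globalModel f d M a y) - (f x - globalModel f d M a x)| ≤
      (M + S) * (d + 1) * ρ ^ d * ‖y - x‖ := by
  have h1 := abs_taylor_remainder_sub_le hf hlip a (y - a) (x - a) hy hx
  have h2 := abs_norm_pow_sub_norm_pow_le hy hx d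
  rw [sub_sub_sub_cancel_right] at h1 h2
  rw [add_sub_cancel, add_sub_cancel] at h1
  change |(f y - taylorExpansion f d a y) - (f x - taylorExpansion f d a x)| ≤ _ at h1
  have h3 : |regParam f d M a * (‖y - a‖ ^ (d + 1) - ‖x - a‖ ^ (d + 1))| ≤
      S * ((d + 1) * ρ ^ d * ‖y - x‖) := by
    rw [abs_mul, abs_of_nonneg (regParam_nonneg f d M a)]
    exact mul_le_mul hS h2 (abs_nonneg _) ((regParam_nonneg f d M a).trans hS)
  calc _ = |((f y - taylorExpansion f d a y) - (f x - taylorExpansion f d a x)) -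
        regParam f d M a * (‖y - a‖ ^ (d + 1) - ‖x - a‖ ^ (d + 1))| := by
        rw [globalModel_eq, globalModel_eq]; congr 1; ring
    _ ≤ _ := (abs_sub _ _).trans (add_le_add h1 h3)
    _ = _ := by ring

/-- Convergence of order `d` of a single step between points of a compact convex set. -/
theorem exists_local_order (hf : ContDiff ℝ d f) (hd : 2 ≤ d)
    (hlip : LipschitzWith M (iteratedFDeriv ℝ d f)) {K : Set (RSpace n)} (hK : Convex ℝ K)
    (hKc : IsCompact K) {μ S : ℝ} (hμ : 0 < μ)
    (hμK : ∀ x ∈ K, ∀ v, μ * ‖v‖ ^ 2 ≤ iteratedFDeriv ℝ 2 f x fun _ => v)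
    (hS : ∀ a ∈ K, regParam f d M a ≤ S) {xs : RSpace n} (hxs : xs ∈ K)
    (hmin : IsGlobalMinimizer f xs) :
    ∃ c : ℝ, 0 < c ∧ ∀ a ∈ K, ∀ y ∈ K, IsGlobalMinimizer (globalModel f d M a) y →
      ‖y - xs‖ ≤ c * ‖a - xs‖ ^ d := by
  have hS0 : 0 ≤ S := (regParam_nonneg f d M xs).trans (hS xs hxs)
  obtain ⟨D, hD0, hD⟩ : ∃ D : ℝ, 0 ≤ D ∧ ∀ a ∈ K, ‖a - xs‖ ≤ D := by
    obtain ⟨D, hD⟩ := hKc.isBounded.subset_closedBall xs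
    refine ⟨max D 0, le_max_right _ _, fun a ha => le_max_of_le_left ?_⟩
    simpa [dist_eq_norm] using hD ha
  set Q := √(2 * ((M + S) * D ^ (d - 1)) / μ)
  have hQ : 0 ≤ Q := Real.sqrt_nonneg _
  refine ⟨2 * ((M + S) * (d + 1) * (1 + Q) ^ d) / μ + 1, by positivity, fun a ha y hy hmy => ?_⟩
  have hquad := quadratic_growth_of_isMinOn hf hd hK hμK hxs hy hmin
  -- A first linear bound, from quadratic growth and the trial point `xs`, places both `y` and `xs`
  -- within `ρ = (1 + Q)‖a - xs‖` of `a`.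
  have hcrude : ‖y - xs‖ ≤ Q * ‖a - xs‖ := by
    have h1 := step_le hf (by omega) hlip hmy (hS a ha) xs
    have h2 : ‖xs - a‖ ^ (d + 1) ≤ D ^ (d - 1) * ‖a - xs‖ ^ 2 := by
      rw [norm_sub_rev, show d + 1 = (d - 1) + 2 by omega, pow_add]
      gcongr
      exact hD a ha
    have h3 : (M + S) * ‖xs - a‖ ^ (d + 1) ≤ (M + S) * (D ^ (d - 1) * ‖a - xs‖ ^ 2) := by gcongr
    refine le_of_sq_le_sq ?_ (by positivity)
    rw [mul_pow, Real.sq_sqrt (by positivity), div_mul_eq_mul_div, le_div_iff₀ hμ]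
    linarith
  set ρ := (1 + Q) * ‖a - xs‖
  have hx : ‖xs - a‖ ≤ ρ := by
    rw [norm_sub_rev]
    exact le_mul_of_one_le_left (norm_nonneg _) (by linarith)
  have hyρ : ‖y - a‖ ≤ ρ := by
    have := norm_sub_le_norm_sub_add_norm_sub y xs a
    rw [norm_sub_rev xs a] at this
    simp only [ρ]
    linarith
  have herr := (le_abs_self _).trans (abs_model_error_sub_le hf hlip (hS a ha) hx hyρ)
  -- As `y` minimizes the model, `f y - f xs` is at most the increment of the model error from `xs`
  -- to `y`.
  have hkey : μ / 2 * ‖y - xs‖ ^ 2 ≤ (M + S) * (d + 1) * ρ ^ d * ‖y - xs‖ := by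
    linarith [hmy xs]
  rcases (norm_nonneg (y - xs)).eq_or_lt with h0 | h0
  · rw [← h0]; positivity
  · have h4 : μ / 2 * ‖y - xs‖ ≤ (M + S) * (d + 1) * ρ ^ d := by
      rw [sq, ← mul_assoc] at hkey
      exact le_of_mul_le_mul_right hkey h0
    have h5 : ‖y - xs‖ ≤ 2 * ((M + S) * (d + 1) * (1 + Q) ^ d) / μ * ‖a - xs‖ ^ d := by
      rw [div_mul_eq_mul_div, le_div_iff₀ hμ]
      simp only [ρ, mul_pow] at h4
      linarith
    refine h5.trans ?_
    gcongr
    linarith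

/-- The recursion `δ' ≤ (1 - τ) δ + L τ ^ (d + 1)` for all `τ ∈ [0, 1]` forces `δ = O(k ^ (-d))`. -/
theorem rate_of_recursion {δ : ℕ → ℝ} (hδ : ∀ k, 0 ≤ δ k) {L : ℝ} (hL : 0 ≤ L)
    (hrec : ∀ k, ∀ τ ∈ Set.Icc (0 : ℝ) 1, δ (k + 1) ≤ (1 - τ) * δ k + L * τ ^ (d + 1)) (k : ℕ)
    (hk : 1 ≤ k) : δ k ≤ L * (d + 1) ^ (d + 1) / (k : ℝ) ^ d := by
  set G := L * (d + 1) ^ (d + 1)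
  -- The weight is `k(k+1)⋯(k+d)`. With `τ = (d+1)/(k+d+1)` the factor `1 - τ` turns the next weight
  -- into the current one, so each step adds at most `G`. At `k = 0` the weight vanishes, so `δ 0`
  -- does not enter.
  have hind : ∀ k : ℕ, (k.ascFactorial (d + 1) : ℝ) * δ k ≤ k * G := by
    intro k
    induction k with
    | zero => simp [Nat.zero_ascFactorial]
    | succ k ih =>
      have hm : (0 : ℝ) < k + (d + 1) := by positivity
      have h1 := hrec k ((d + 1) / (k + (d + 1)))
        ⟨by positivity, by rw [div_le_one hm]; linarith [(Nat.cast_nonneg k : (0 : ℝ) ≤ k)]⟩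
      have h2 : ((k : ℝ) + (d + 1)) * k.ascFactorial (d + 1) =
          k * (k + 1).ascFactorial (d + 1) := by
        exact_mod_cast (Nat.succ_ascFactorial k (d + 1)).symm
      have h3 : ((k + 1).ascFactorial (d + 1) : ℝ) ≤ (k + (d + 1)) ^ (d + 1) := by
        exact_mod_cast Nat.ascFactorial_le_pow_add k (d + 1)
      have h4 : (1 - ((d : ℝ) + 1) / (k + (d + 1))) = k / (k + (d + 1)) := by
        field_simp; ring
      rw [h4, div_pow] at h1
      calc ((k + 1).ascFactorial (d + 1) : ℝ) * δ (k + 1)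
          ≤ (k + 1).ascFactorial (d + 1) * (k / (k + (d + 1)) * δ k +
              L * ((d + 1) ^ (d + 1) / (k + (d + 1)) ^ (d + 1))) := by gcongr
        _ = (k * (k + 1).ascFactorial (d + 1)) / (k + (d + 1)) * δ k +
              ((k + 1).ascFactorial (d + 1) / (k + (d + 1)) ^ (d + 1)) * G := by
            simp only [G]; ring
        _ ≤ k.ascFactorial (d + 1) * δ k + 1 * G := by
            rw [← h2, mul_div_cancel_left₀ _ hm.ne']
            gcongr
            rw [div_le_one (by positivity)]
            exact h3
        _ ≤ ((k + 1 : ℕ) : ℝ) * G := by push_cast; linarith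
  have hk0 : (0 : ℝ) < k := by exact_mod_cast hk
  have h1 : (k : ℝ) ^ (d + 1) ≤ k.ascFactorial (d + 1) := by
    exact_mod_cast Nat.pow_succ_le_ascFactorial k (d + 1)
  rw [le_div_iff₀ (by positivity)]
  refine le_of_mul_le_mul_left ?_ hk0
  calc k * (δ k * (k : ℝ) ^ d) = (k : ℝ) ^ (d + 1) * δ k := by ring
    _ ≤ k.ascFactorial (d + 1) * δ k := mul_le_mul_of_nonneg_right h1 (hδ k)
    _ ≤ k * G := hind k

/-- The trial point `x k + τ • (xs - x k)` and convexity of `f` give the recursion of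
`rate_of_recursion`, with `L = (M + S) D^(d+1)`. -/
theorem exists_rate (hf : ContDiff ℝ d f) (hd : 1 ≤ d) (hconv : ConvexOn ℝ Set.univ f)
    (hlip : LipschitzWith M (iteratedFDeriv ℝ d f)) {K : Set (RSpace n)} (hKc : IsCompact K) {S : ℝ}
    (hS : ∀ a ∈ K, regParam f d M a ≤ S) {xs : RSpace n} (hmin : IsGlobalMinimizer f xs)
    {x : ℕ → RSpace n} (hx : IsGlobalNewtonSequence f d M x) (hxK : ∀ k, x k ∈ K) :
    ∃ C : ℝ, ∀ k : ℕ, 1 ≤ k → f (x k) - f xs ≤ C / (k : ℝ) ^ d := by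
  have hS0 : 0 ≤ S := (regParam_nonneg f d M _).trans (hS _ (hxK 0))
  obtain ⟨D, hD⟩ := hKc.isBounded.subset_closedBall xs
  have hDx : ∀ k, ‖xs - x k‖ ≤ D := fun k => by
    have := hD (hxK k)
    rwa [Metric.mem_closedBall, dist_comm, dist_eq_norm] at this
  have hD0 : 0 ≤ D := (norm_nonneg _).trans (hDx 0)
  refine ⟨_, rate_of_recursion (d := d) (L := (M + S) * D ^ (d + 1))
    (fun k => sub_nonneg.2 (hmin _)) (by positivity) fun k τ hτ => ?_⟩
  have h1 := step_le hf hd hlip (hx k) (hS _ (hxK k)) (x k + τ • (xs - x k))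
  have h2 := hconv.2 (Set.mem_univ (x k)) (Set.mem_univ xs) (sub_nonneg.2 hτ.2) hτ.1 (by ring)
  have e : (1 - τ) • x k + τ • xs = x k + τ • (xs - x k) := by module
  rw [e, smul_eq_mul, smul_eq_mul] at h2
  rw [add_sub_cancel_left, norm_smul, Real.norm_eq_abs, abs_of_nonneg hτ.1] at h1
  have h3 : (M + S) * (τ * ‖xs - x k‖) ^ (d + 1) ≤ (M + S) * D ^ (d + 1) * τ ^ (d + 1) := by
    rw [mul_assoc, ← mul_pow, mul_comm D]
    have := hτ.1
    gcongr
    exact hDx k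
  linarith

theorem exists_regParam_bound (hd : Odd d) (hd3 : 3 ≤ d) (hf : ContDiff ℝ d f)
    (hpos : ∀ x v : RSpace n, v ≠ 0 → 0 < iteratedFDeriv ℝ 2 f x fun _ => v) (M : ℝ)
    {K : Set (RSpace n)} (hK : IsCompact K) : ∃ S : ℝ, ∀ a ∈ K, regParam f d M a ≤ S := by
  obtain ⟨t, ht⟩ := exists_uniform_feasible hd hd3 hf hpos hK
  exact ⟨max _ t, fun a ha => max_le_max le_rfl (optReg_le (ht a ha))⟩

end Convergence

/-! ### Assembly on sublevel sets. -/

theorem mainTheorem3 (n d : ℕ) (hd : Odd d) (hd3 : 3 ≤ d) (M : ℝ≥0)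
    (f : RSpace n → ℝ) (hf : ContDiff ℝ d f)
    (hlevel : ∀ c : ℝ, Bornology.IsBounded {x : RSpace n | f x ≤ c})
    (hhess : ∀ x v : RSpace n, v ≠ 0 → 0 < iteratedFDeriv ℝ 2 f x ![v, v])
    (hlip : LipschitzWith M (iteratedFDeriv ℝ d f)) :
    -- every iteration is well defined
    (∀ a : RSpace n, (feasibleReg f d a).Nonempty ∧
      ∃! y : RSpace n, IsGlobalMinimizer (globalModel f d M a) y) ∧
    ∃ xstar : RSpace n,
      -- `xstar` is the unique minimizer of `f`
      (IsGlobalMinimizer f xstar ∧ ∀ y : RSpace n, IsGlobalMinimizer f y → y = xstar) ∧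
      -- global convergence from any starting point, with rate `O(k ^ (-d))` in function value
      (∀ x : ℕ → RSpace n, IsGlobalNewtonSequence f d M x →
        Filter.Tendsto x Filter.atTop (nhds xstar) ∧
        ∃ C : ℝ, ∀ k : ℕ, 1 ≤ k → f (x k) - f xstar ≤ C / (k : ℝ) ^ d) ∧
      -- local convergence of order `d`
      (∃ r c : ℝ, 0 < r ∧ 0 < c ∧
        ∀ x : ℕ → RSpace n, IsGlobalNewtonSequence f d M x → ‖x 0 - xstar‖ ≤ r →
          ∀ k : ℕ, ‖x (k + 1) - xstar‖ ≤ c * ‖x k - xstar‖ ^ d) := by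
  have hpos : ∀ x v : RSpace n, v ≠ 0 → 0 < iteratedFDeriv ℝ 2 f x fun _ => v := by
    intro x v hv
    convert hhess x v hv using 2
    funext i
    fin_cases i <;> rfl
  have hfeas : ∀ a : RSpace n, (feasibleReg f d a).Nonempty := fun a => by
    obtain ⟨t, ht⟩ := exists_uniform_feasible hd hd3 hf hpos (isCompact_singleton (x := a))
    exact ⟨t, ht a rfl⟩
  refine ⟨fun a => ⟨hfeas a,
    existsUnique_globalModel_minimizer hd hd3 M (hpos a) (hfeas a)⟩, ?_⟩
  have hcont : Continuous f := hf.continuous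
  have hcomp : ∀ c : ℝ, IsCompact {x : RSpace n | f x ≤ c} := fun c =>
    Metric.isCompact_of_isClosed_isBounded (isClosed_le hcont continuous_const) (hlevel c)
  have hconv : ConvexOn ℝ Set.univ f := by
    refine convexOn_univ_of_iteratedFDeriv_two_nonneg hf (by omega) fun x v => ?_
    rcases eq_or_ne v 0 with rfl | hv
    · rw [ContinuousMultilinearMap.map_coord_zero _ (0 : Fin 2) rfl]
    · exact (hpos x v hv).le
  have hconvex : ∀ c : ℝ, Convex ℝ {x : RSpace n | f x ≤ c} := fun c => by
    simpa using hconv.convex_le c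
  have hstay : ∀ x : ℕ → RSpace n, IsGlobalNewtonSequence f d M x → ∀ k, f (x k) ≤ f (x 0) := by
    intro x hx k
    induction k with
    | zero => exact le_rfl
    | succ k ih => exact (step_decreasing hf (by omega) hlip (hx k)).trans ih
  obtain ⟨xs, hxs, hxsmin⟩ := (hcomp (f 0)).exists_isMinOn ⟨0, le_refl (f 0)⟩ hcont.continuousOn
  have hmin : IsGlobalMinimizer f xs := fun z => by
    rcases le_or_gt (f z) (f 0) with h | h
    · exact hxsmin h
    · exact le_trans hxs h.le
  have hgrowth : ∀ c : ℝ, f xs ≤ c → ∃ μ : ℝ, 0 < μ ∧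
      (∀ x ∈ {x : RSpace n | f x ≤ c}, ∀ v, μ * ‖v‖ ^ 2 ≤ iteratedFDeriv ℝ 2 f x fun _ => v) ∧
      ∀ y, f y ≤ c → μ / 2 * ‖y - xs‖ ^ 2 ≤ f y - f xs := by
    intro c hc
    obtain ⟨μ, hμ, hμK⟩ := exists_uniform_pos_def hf (by omega) hpos (hcomp c)
    exact ⟨μ, hμ, hμK, fun y hy =>
      quadratic_growth_of_isMinOn hf (by omega) (hconvex c) hμK hc hy hmin⟩
  refine ⟨xs, ⟨hmin, fun y hy => ?_⟩, fun x hx => ?_, ?_⟩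
  · obtain ⟨μ, hμ, -, h⟩ := hgrowth (f xs) le_rfl
    have h1 := h y (hy xs)
    have h2 : μ / 2 * ‖y - xs‖ ^ 2 ≤ 0 := h1.trans (sub_nonpos.2 (hy xs))
    have h3 : ‖y - xs‖ ^ 2 ≤ 0 := nonpos_of_mul_nonpos_right h2 (half_pos hμ)
    exact sub_eq_zero.1 (norm_eq_zero.1 (pow_eq_zero_iff two_ne_zero |>.1
      (le_antisymm h3 (sq_nonneg _))))
  · obtain ⟨S, hS⟩ := exists_regParam_bound hd hd3 hf hpos M (hcomp (f (x 0)))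
    obtain ⟨C, hC⟩ := exists_rate hf (by omega) hconv hlip (hcomp (f (x 0))) hS hmin hx
      (hstay x hx)
    refine ⟨?_, C, hC⟩
    obtain ⟨μ, hμ, -, h⟩ := hgrowth (f (x 0)) (hmin _)
    have hlim : Filter.Tendsto (fun k : ℕ => 2 / μ * (C / (k : ℝ) ^ d)) Filter.atTop (nhds 0) := by
      have h1 : Filter.Tendsto (fun k : ℕ => (k : ℝ) ^ d) Filter.atTop Filter.atTop :=
        (Filter.tendsto_pow_atTop (by omega)).comp tendsto_natCast_atTop_atTop
      simpa using (h1.const_div_atTop C).const_mul (2 / μ)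
    have hsq : Filter.Tendsto (fun k => ‖x k - xs‖ ^ 2) Filter.atTop (nhds 0) := by
      refine squeeze_zero' (Filter.Eventually.of_forall fun k => by positivity) ?_ hlim
      filter_upwards [Filter.eventually_ge_atTop 1] with k hk
      have h1 := (h (x k) (hstay x hx k)).trans (hC k hk)
      rw [div_mul_eq_mul_div, le_div_iff₀ hμ]
      linarith
    rw [tendsto_iff_norm_sub_tendsto_zero]
    have := (Real.continuous_sqrt.tendsto 0).comp hsq
    simpa [Function.comp_def] using this
  -- The radius `1` is arbitrary. The sublevel set at the maximum of `f` over the ball contains the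
  -- ball and, by descent, all iterates, so the ball itself need not be invariant.
  · obtain ⟨z, -, hz⟩ := (isCompact_closedBall xs (1 : ℝ)).exists_isMaxOn
      ⟨xs, Metric.mem_closedBall_self zero_le_one⟩ hcont.continuousOn
    obtain ⟨S, hS⟩ := exists_regParam_bound hd hd3 hf hpos M (hcomp (f z))
    obtain ⟨μ, hμ, hμK, -⟩ := hgrowth (f z) (hmin z)
    obtain ⟨c, hc, hlocal⟩ := exists_local_order hf (by omega) hlip (hconvex (f z)) (hcomp (f z))
      hμ hμK hS (hmin z) hmin
    refine ⟨1, c, one_pos, hc, fun x hx h0 k => ?_⟩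
    have hx0 : f (x 0) ≤ f z := hz (by rwa [Metric.mem_closedBall, dist_eq_norm])
    exact hlocal _ ((hstay x hx k).trans hx0) _ ((hstay x hx (k + 1)).trans hx0) (hx k)
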